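/- All graphs are finite and simple. A graph $G$ is $k$-vertex-critical if $\chi(G)=k$ and $\chi(G-v)<k$ for every $v\in V(G)$. A graph is $(H_1,H_2)$-free if it has no induced subgraph isomorphic to $H_1$ or to $H_2$. Let $P_n$ be the path on $n$ vertices, let the gem be the graph consisting of a path $P_4$ and one further vertex adjacent to all four vertices of the path, and let $\overline{P_3+P_2}$ be the complement of the disjoint union of $P_3$ and $P_2$. **Theorem.** Up to isomorphism, there are exactly $7$ $5$-vertex-critical $(P_5,\text{gem})$-free graphs, and there are exactly $20$ $5$-vertex-critical $(P_5,\overline{P_3+P_2})$-free graphs. Explicitly, the graphs in each of the following two lists are pairwise non-isomorphic, and a graph belongs to the respective class if and only if it is isomorphic to a graph in the list. (A graph on $\{0,\dots,n-1\}$ is given by its adjacency lists: "$v$: $u_1\ u_2\ \dots$" means that the neighbours of $v$ are $u_1,u_2,\dots$.) The $7$ $5$-vertex-critical $(P_5,\text{gem})$-free graphs: 1. $\{$0: 1 2 3 4; 1: 0 2 3 4; 2: 0 1 3 4; 3: 0 1 2 4; 4: 0 1 2 3$\}$ 2. $\{$0: 1 4 5 6; 1: 0 2 5 6 7 8; 2: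 1 3 7 8; 3: 2 4 7 8; 4: 0 3 5 6; 5: 0 1 4 6; 6: 0 1 4 5; 7: 1 2 3 8; 8: 1 2 3 7$\}$ 3. $\{$0: 1 4 5 6; 1: 0 2 5 6; 2: 1 3 6 7 8; 3: 2 4 7 8; 4: 0 3 5 7 8; 5: 0 1 4 6; 6: 0 1 2 5; 7: 2 3 4 8; 8: 2 3 4 7$\}$ 4. $\{$0: 1 4 5 6 7; 1: 0 2 5 6 8; 2: 1 3 6 8; 3: 2 4 7 8; 4: 0 3 5 7; 5: 0 1 4 6 7; 6: 0 1 2 5 8; 7: 0 3 4 5; 8: 1 2 3 6$\}$ 5. $\{$0: 1 4 5 6; 1: 0 2 5 6 7 8 12; 2: 1 3 7 12; 3: 2 4 6 7 8 12; 4: 0 3 5 8; 5: 0 1 4 6; 6: 0 1 3 5 9 10 11; 7: 1 2 3 12; 8: 1 3 4 9 10 11; 9: 6 8 10 11; 10: 6 8 9 11; 11: 6 8 9 10; 12: 1 2 3 7$\}$ 6. $\{$0: 1 4 5 6 7 8; 1: 0 2 5 6; 2: 1 3 6 7 8 12; 3: 2 4 8 12; 4: 0 3 5 7 12; 5: 0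 1 4 6 7 8; 6: 0 1 2 5; 7: 0 2 4 5 9 10 11; 8: 0 2 3 5 9 10 11 12; 9: 7 8 10 11; 10: 7 8 9 11; 11: 7 8 9 10; 12: 2 3 4 8$\}$ 7. $\{$0: 1 4 5 6 7 8; 1: 0 2 5 6 12; 2: 1 3 6 7 8 12; 3: 2 4 8 12; 4: 0 3 5 7; 5: 0 1 4 6 7 8; 6: 0 1 2 5 12; 7: 0 2 4 5 9 10 11 12; 8: 0 2 3 5 9 10 11 12; 9: 7 8 10 11; 10: 7 8 9 11; 11: 7 8 9 10; 12: 1 2 3 6 7 8$\}$ The $20$ $5$-vertex-critical $(P_5,\overline{P_3+P_2})$-free graphs: 1. $\{$0: 1 2 3 4; 1: 0 2 3 4; 2: 0 1 3 4; 3: 0 1 2 4; 4: 0 1 2 3$\}$ 2. $\{$0: 1 4 5 6; 1: 0 2 5 6; 2: 1 3 5 6; 3: 2 4 5 6; 4: 0 3 5 6; 5: 0 1 2 3 4 6; 6: 0 1 2 3 4 5$\}$ 3. $\{$0: 1 4 5 6 7; 1: 0 2 5 6 7; 2: 1 3 5 7; 3: 2 4 6 7; 4: 0 3 5 7; 5: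 0 1 2 4 7; 6: 0 1 3 7; 7: 0 1 2 3 4 5 6$\}$ 4. $\{$0: 1 4 5 6 7; 1: 0 2 5 6 7; 2: 1 3 6 7; 3: 2 4 6 7; 4: 0 3 5 6; 5: 0 1 4 6; 6: 0 1 2 3 4 5 7; 7: 0 1 2 3 6$\}$ 5. $\{$0: 1 4 5 6 7; 1: 0 2 5 6 7; 2: 1 3 5 6 7; 3: 2 4 6 7; 4: 0 3 5 7; 5: 0 1 2 4 7; 6: 0 1 2 3 7; 7: 0 1 2 3 4 5 6$\}$ 6. $\{$0: 1 4 5 6; 1: 0 2 5 6 7; 2: 1 3 6 7; 3: 2 4 6 7; 4: 0 3 5 6; 5: 0 1 4 6; 6: 0 1 2 3 4 5 7; 7: 1 2 3 6$\}$ 7. $\{$0: 1 4 5 6; 1: 0 2 5 6 7 8; 2: 1 3 7 8; 3: 2 4 7 8; 4: 0 3 5 6; 5: 0 1 4 6; 6: 0 1 4 5; 7: 1 2 3 8; 8: 1 2 3 7$\}$ 8. $\{$0: 1 4 5 6 7 8; 1: 0 2 5 6 7 8; 2: 1 3 6 7; 3: 2 4 7 8; 4: 0 3 5 6 8; 5: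 0 1 4 6 8; 6: 0 1 2 4 5; 7: 0 1 2 3 8; 8: 0 1 3 4 5 7$\}$ 9. $\{$0: 1 4 5 6 7 8; 1: 0 2 5 6 7; 2: 1 3 5 6 8; 3: 2 4 6 7 8; 4: 0 3 5 7 8; 5: 0 1 2 4 8; 6: 0 1 2 3 7 8; 7: 0 1 3 4 6; 8: 0 2 3 4 5 6$\}$ 10. $\{$0: 1 4 5 6; 1: 0 2 5 6; 2: 1 3 6 7 8; 3: 2 4 7 8; 4: 0 3 5 7 8; 5: 0 1 4 6; 6: 0 1 2 5; 7: 2 3 4 8; 8: 2 3 4 7$\}$ 11. $\{$0: 1 4 5 6 7; 1: 0 2 5 6 8; 2: 1 3 6 8; 3: 2 4 7 8; 4: 0 3 5 7; 5: 0 1 4 6 7; 6: 0 1 2 5 8; 7: 0 3 4 5; 8: 1 2 3 6$\}$ 12. $\{$0: 1 4 5 6 7; 1: 0 2 5 6 7; 2: 1 3 6 7 8; 3: 2 4 7 8; 4: 0 3 5 7 8; 5: 0 1 4 6 8; 6: 0 1 2 5 8; 7: 0 1 2 3 4; 8: 2 3 4 5 6$\}$ 13. $\{$0: 1 4 5 6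 7; 1: 0 2 5 6 7; 2: 1 3 6 7 8; 3: 2 4 7 8; 4: 0 3 5 7 8; 5: 0 1 4 6; 6: 0 1 2 5; 7: 0 1 2 3 4 8; 8: 2 3 4 7$\}$ 14. $\{$0: 1 4 5 6 7 8; 1: 0 2 5 6 7; 2: 1 3 6 7; 3: 2 4 7 8; 4: 0 3 5 7 8; 5: 0 1 4 6 8; 6: 0 1 2 5 8; 7: 0 1 2 3 4; 8: 0 3 4 5 6$\}$ 15. $\{$0: 1 4 5 6 7 8; 1: 0 2 5 6 7; 2: 1 3 6 7 8; 3: 2 4 7 8; 4: 0 3 5 7 8; 5: 0 1 4 6; 6: 0 1 2 5 8; 7: 0 1 2 3 4 8; 8: 0 2 3 4 6 7$\}$ 16. $\{$0: 1 4 5 6 7 8; 1: 0 2 5 6 7 8; 2: 1 3 6 7 8; 3: 2 4 7 8; 4: 0 3 5 7; 5: 0 1 4 6; 6: 0 1 2 5 8; 7: 0 1 2 3 4 8; 8: 0 1 2 3 6 7$\}$ 17. $\{$0: 1 4 5 6 7; 1: 0 2 5 6 7 8; 2: 1 3 6 7 8; 3: 2 4 7 8; 4: 0 3 5 6; 5: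 0 1 4 6; 6: 0 1 2 4 5; 7: 0 1 2 3 8; 8: 1 2 3 7$\}$ 18. $\{$0: 1 4 5 6 7; 1: 0 2 5 6 7 8; 2: 1 3 6 7 8; 3: 2 4 7 8; 4: 0 3 5 6; 5: 0 1 4 6 8; 6: 0 1 2 4 5; 7: 0 1 2 3 8; 8: 1 2 3 5 7$\}$ 19. $\{$0: 1 4 5 6 8; 1: 0 2 5 6 7 8; 2: 1 3 6 7; 3: 2 4 6 7; 4: 0 3 5 6 8; 5: 0 1 4 6 8; 6: 0 1 2 3 4 5; 7: 1 2 3 8; 8: 0 1 4 5 7$\}$ 20. $\{$0: 1 4 5 6; 1: 0 2 5 6 7 8; 2: 1 3 6 7 8; 3: 2 4 7 8; 4: 0 3 5 6; 5: 0 1 4 6; 6: 0 1 2 4 5; 7: 1 2 3 8; 8: 1 2 3 7$\}$ -/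

import Mathlib

open scoped SimpleGraph

/-- A graph `G` is `k`-vertex-critical if `χ(G) = k` and `χ(G - v) < k` for every vertex `v`. -/
def IsVertexCritical {V : Type*} (k : ℕ) (G : SimpleGraph V) : Prop :=
  G.chromaticNumber = k ∧ ∀ v : V, (G.induce {v}ᶜ).chromaticNumber < k

/-- `G` is `(H₁, H₂)`-free: neither `H₁` nor `H₂` is isomorphic to an induced subgraph of `G`. -/
def IsPairFree {V W₁ W₂ : Type*} (H₁ : SimpleGraph W₁) (H₂ : SimpleGraph W₂)
    (G : SimpleGraph V) : Prop :=
  ¬ H₁.IsIndContained G ∧ ¬ H₂.IsIndContained G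

/-- The gem: the path `0 - 1 - 2 - 3` together with the vertex `4`, adjacent to all of it. -/
def gem : SimpleGraph (Fin 5) :=
  SimpleGraph.fromRel fun i j => (i : ℕ) + 1 = j ∨ j = 4

/-- The complement of the disjoint union `P₃ + P₂`. -/
def coP3P2 : SimpleGraph (Fin 3 ⊕ Fin 2) :=
  (SimpleGraph.pathGraph 3 ⊕g SimpleGraph.pathGraph 2)ᶜ

/-- Two finite graphs are equivalent if they are isomorphic. -/
def isoSetoid : Setoid (Σ n : ℕ, SimpleGraph (Fin n)) where
  r G H := Nonempty (G.2 ≃g H.2)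
  iseqv := ⟨fun _ => ⟨SimpleGraph.Iso.refl⟩, fun ⟨e⟩ => ⟨e.symm⟩, fun ⟨e⟩ ⟨f⟩ => ⟨e.trans f⟩⟩

/-- The isomorphism classes of finite graphs. -/
def IsoClass : Type := Quotient isoSetoid

/-- The isomorphism class of a graph on `{0, …, n - 1}`. -/
def isoClass {n : ℕ} (G : SimpleGraph (Fin n)) : IsoClass := Quotient.mk isoSetoid ⟨n, G⟩

/-- The set of isomorphism classes of the finite `k`-vertex-critical `(H₁, H₂)`-free graphs. -/
def criticalClasses {W₁ W₂ : Type*} (k : ℕ) (H₁ : SimpleGraph W₁) (H₂ : SimpleGraph W₂) :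
    Set IsoClass :=
  {c | ∃ (n : ℕ) (G : SimpleGraph (Fin n)),
    isoClass G = c ∧ IsVertexCritical k G ∧ IsPairFree H₁ H₂ G}

/-- The graph on `{0, …, n - 1}` with the adjacency lists `L = [N(0), …, N(n - 1)]`. -/
def adjListGraph (L : List (List ℕ)) : SimpleGraph (Fin L.length) :=
  SimpleGraph.fromRel fun i j => (j : ℕ) ∈ L[i]

/-- Adjacency lists of seven graphs; the `i`-th entry of a graph is the neighbourhood of `i`. -/
def gemList : List (List (List ℕ)) :=
  [[[1, 2, 3, 4], [0, 2, 3, 4], [0, 1, 3, 4], [0, 1, 2, 4], [0, 1, 2, 3]],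
   [[1, 4, 5, 6], [0, 2, 5, 6, 7, 8], [1, 3, 7, 8], [2, 4, 7, 8], [0, 3, 5, 6], [0, 1, 4, 6],
    [0, 1, 4, 5], [1, 2, 3, 8], [1, 2, 3, 7]],
   [[1, 4, 5, 6], [0, 2, 5, 6], [1, 3, 6, 7, 8], [2, 4, 7, 8], [0, 3, 5, 7, 8], [0, 1, 4, 6],
    [0, 1, 2, 5], [2, 3, 4, 8], [2, 3, 4, 7]],
   [[1, 4, 5, 6, 7], [0, 2, 5, 6, 8], [1, 3, 6, 8], [2, 4, 7, 8], [0, 3, 5, 7],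
    [0, 1, 4, 6, 7], [0, 1, 2, 5, 8], [0, 3, 4, 5], [1, 2, 3, 6]],
   [[1, 4, 5, 6], [0, 2, 5, 6, 7, 8, 12], [1, 3, 7, 12], [2, 4, 6, 7, 8, 12], [0, 3, 5, 8],
    [0, 1, 4, 6], [0, 1, 3, 5, 9, 10, 11], [1, 2, 3, 12], [1, 3, 4, 9, 10, 11],
    [6, 8, 10, 11], [6, 8, 9, 11], [6, 8, 9, 10], [1, 2, 3, 7]],
   [[1, 4, 5, 6, 7, 8], [0, 2, 5, 6], [1, 3, 6, 7, 8, 12], [2, 4, 8, 12], [0, 3, 5, 7, 12],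
    [0, 1, 4, 6, 7, 8], [0, 1, 2, 5], [0, 2, 4, 5, 9, 10, 11], [0, 2, 3, 5, 9, 10, 11, 12],
    [7, 8, 10, 11], [7, 8, 9, 11], [7, 8, 9, 10], [2, 3, 4, 8]],
   [[1, 4, 5, 6, 7, 8], [0, 2, 5, 6, 12], [1, 3, 6, 7, 8, 12], [2, 4, 8, 12], [0, 3, 5, 7],
    [0, 1, 4, 6, 7, 8], [0, 1, 2, 5, 12], [0, 2, 4, 5, 9, 10, 11, 12],
    [0, 2, 3, 5, 9, 10, 11, 12], [7, 8, 10, 11], [7, 8, 9, 11], [7, 8, 9, 10],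
    [1, 2, 3, 6, 7, 8]]]

/-- Adjacency lists of twenty graphs; the `i`-th entry of a graph is the neighbourhood of `i`. -/
def coP3P2List : List (List (List ℕ)) :=
  [[[1, 2, 3, 4], [0, 2, 3, 4], [0, 1, 3, 4], [0, 1, 2, 4], [0, 1, 2, 3]],
   [[1, 4, 5, 6], [0, 2, 5, 6], [1, 3, 5, 6], [2, 4, 5, 6], [0, 3, 5, 6], [0, 1, 2, 3, 4, 6],
    [0, 1, 2, 3, 4, 5]],
   [[1, 4, 5, 6, 7], [0, 2, 5, 6, 7], [1, 3, 5, 7], [2, 4, 6, 7], [0, 3, 5, 7],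
    [0, 1, 2, 4, 7], [0, 1, 3, 7], [0, 1, 2, 3, 4, 5, 6]],
   [[1, 4, 5, 6, 7], [0, 2, 5, 6, 7], [1, 3, 6, 7], [2, 4, 6, 7], [0, 3, 5, 6], [0, 1, 4, 6],
    [0, 1, 2, 3, 4, 5, 7], [0, 1, 2, 3, 6]],
   [[1, 4, 5, 6, 7], [0, 2, 5, 6, 7], [1, 3, 5, 6, 7], [2, 4, 6, 7], [0, 3, 5, 7],
    [0, 1, 2, 4, 7], [0, 1, 2, 3, 7], [0, 1, 2, 3, 4, 5, 6]],
   [[1, 4, 5, 6], [0, 2, 5, 6, 7], [1, 3, 6, 7], [2, 4, 6, 7], [0, 3, 5, 6], [0, 1, 4, 6],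
    [0, 1, 2, 3, 4, 5, 7], [1, 2, 3, 6]],
   [[1, 4, 5, 6], [0, 2, 5, 6, 7, 8], [1, 3, 7, 8], [2, 4, 7, 8], [0, 3, 5, 6], [0, 1, 4, 6],
    [0, 1, 4, 5], [1, 2, 3, 8], [1, 2, 3, 7]],
   [[1, 4, 5, 6, 7, 8], [0, 2, 5, 6, 7, 8], [1, 3, 6, 7], [2, 4, 7, 8], [0, 3, 5, 6, 8],
    [0, 1, 4, 6, 8], [0, 1, 2, 4, 5], [0, 1, 2, 3, 8], [0, 1, 3, 4, 5, 7]],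
   [[1, 4, 5, 6, 7, 8], [0, 2, 5, 6, 7], [1, 3, 5, 6, 8], [2, 4, 6, 7, 8], [0, 3, 5, 7, 8],
    [0, 1, 2, 4, 8], [0, 1, 2, 3, 7, 8], [0, 1, 3, 4, 6], [0, 2, 3, 4, 5, 6]],
   [[1, 4, 5, 6], [0, 2, 5, 6], [1, 3, 6, 7, 8], [2, 4, 7, 8], [0, 3, 5, 7, 8], [0, 1, 4, 6],
    [0, 1, 2, 5], [2, 3, 4, 8], [2, 3, 4, 7]],
   [[1, 4, 5, 6, 7], [0, 2, 5, 6, 8], [1, 3, 6, 8], [2, 4, 7, 8], [0, 3, 5, 7],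
    [0, 1, 4, 6, 7], [0, 1, 2, 5, 8], [0, 3, 4, 5], [1, 2, 3, 6]],
   [[1, 4, 5, 6, 7], [0, 2, 5, 6, 7], [1, 3, 6, 7, 8], [2, 4, 7, 8], [0, 3, 5, 7, 8],
    [0, 1, 4, 6, 8], [0, 1, 2, 5, 8], [0, 1, 2, 3, 4], [2, 3, 4, 5, 6]],
   [[1, 4, 5, 6, 7], [0, 2, 5, 6, 7], [1, 3, 6, 7, 8], [2, 4, 7, 8], [0, 3, 5, 7, 8],
    [0, 1, 4, 6], [0, 1, 2, 5], [0, 1, 2, 3, 4, 8], [2, 3, 4, 7]],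
   [[1, 4, 5, 6, 7, 8], [0, 2, 5, 6, 7], [1, 3, 6, 7], [2, 4, 7, 8], [0, 3, 5, 7, 8],
    [0, 1, 4, 6, 8], [0, 1, 2, 5, 8], [0, 1, 2, 3, 4], [0, 3, 4, 5, 6]],
   [[1, 4, 5, 6, 7, 8], [0, 2, 5, 6, 7], [1, 3, 6, 7, 8], [2, 4, 7, 8], [0, 3, 5, 7, 8],
    [0, 1, 4, 6], [0, 1, 2, 5, 8], [0, 1, 2, 3, 4, 8], [0, 2, 3, 4, 6, 7]],
   [[1, 4, 5, 6, 7, 8], [0, 2, 5, 6, 7, 8], [1, 3, 6, 7, 8], [2, 4, 7, 8], [0, 3, 5, 7],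
    [0, 1, 4, 6], [0, 1, 2, 5, 8], [0, 1, 2, 3, 4, 8], [0, 1, 2, 3, 6, 7]],
   [[1, 4, 5, 6, 7], [0, 2, 5, 6, 7, 8], [1, 3, 6, 7, 8], [2, 4, 7, 8], [0, 3, 5, 6],
    [0, 1, 4, 6], [0, 1, 2, 4, 5], [0, 1, 2, 3, 8], [1, 2, 3, 7]],
   [[1, 4, 5, 6, 7], [0, 2, 5, 6, 7, 8], [1, 3, 6, 7, 8], [2, 4, 7, 8], [0, 3, 5, 6],
    [0, 1, 4, 6, 8], [0, 1, 2, 4, 5], [0, 1, 2, 3, 8], [1, 2, 3, 5, 7]],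
   [[1, 4, 5, 6, 8], [0, 2, 5, 6, 7, 8], [1, 3, 6, 7], [2, 4, 6, 7], [0, 3, 5, 6, 8],
    [0, 1, 4, 6, 8], [0, 1, 2, 3, 4, 5], [1, 2, 3, 8], [0, 1, 4, 5, 7]],
   [[1, 4, 5, 6], [0, 2, 5, 6, 7, 8], [1, 3, 6, 7, 8], [2, 4, 7, 8], [0, 3, 5, 6],
    [0, 1, 4, 6], [0, 1, 2, 4, 5], [1, 2, 3, 8], [1, 2, 3, 7]]]

/-! A graph is `5`-vertex-critical exactly if it is not `4`-colourable but loses this property with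
any vertex (`IsCritical`). A critical graph has no proper critical induced subgraph, since a
colouring of `G - v` restricts to every induced subgraph avoiding `v`. As the listed graphs are
critical, it is enough that every critical graph `G` of the class contains a listed graph as an
induced subgraph (`nonempty_iso_of_isCopy`). Finiteness of `G` plays no role in this.

Containment is proved by an exhaustive search, guided by a certificate. A state consists of some
placed vertices, which induce a known subgraph, and of the possible types of all other vertices, a
type being a neighbourhood on the placed vertices. A type is discarded if a vertex of this type
would form a forbidden five-vertex graph with four placed vertices. Criticality forces a further
vertex in three ways. If a set `S` is moved off itself by a map `φ` which preserves its edges, some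
vertex outside `S` is adjacent to an `a ∈ S` and not to `φ a`; otherwise a colouring of `G - s` with
`s ∈ S` could be copied along `φ`. Every degree is at least `4`. A nonempty `4`-colourable set of
vertices has a neighbour outside. The search branches over the types of the forced vertex, and a
type whose branch is closed does not occur at all. By `check_sound` a critical graph of the class
without listed subgraph defeats every certificate.

There are two runs. Since `K₅` is listed, it may be treated as forbidden. The first run shows that
there is no induced `C₅`, by excluding the types of a vertex on such a cycle up to symmetry
(`not_exists_cycle`). The second forbids `C₅` as well and starts from one vertex. Its success is
plausible: holes of length at least `6` contain `P₅`, and the complements of longer odd cycles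
contain both the gem and the complement of `P₃ + P₂`, so what remains is perfect, and `4`-colourable
without `K₅`. The search replaces the strong perfect graph theorem.

Conversely, complete searches for colourings and induced copies verify the listed graphs and tell
them apart. Sets are coded as bit masks, and the definitions use recursors and bare `Nat`
operations, to make evaluation in the kernel feasible. -/

/-- The first `n` digits of `c` in base `b`. -/
def digitsBelow (b : ℕ) : ℕ → ℕ → List ℕ
  | 0, _ => []
  | n + 1, c => Nat.mod c b :: digitsBelow b n (Nat.div c b)

/-- The bit `i` of `t`. -/
def bit (t i : ℕ) : Bool := !Nat.beq (Nat.land (Nat.shiftRight t i) 1) 0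

/-- The number with the given binary digits, lowest digit first. -/
def encode : List Bool → ℕ
  | [] => 0
  | true :: l => Nat.add (Nat.mul 2 (encode l)) 1
  | false :: l => Nat.mul 2 (encode l)

/-! ### The table of forbidden five-vertex graphs -/

/-- The code of the labelled graph `a, b ↦ h p[a] p[b]` on five vertices. -/
def labelCode (h : ℕ → ℕ → Bool) : List ℕ → ℕ
  | [w, i, j, k, x] =>
    -- The order of the pairs is that of the levels of `killTree`: the graph on the first four
    -- vertices, then the adjacencies of the fifth.
    encode [h w i, h w j, h i j, h w k, h i k, h j k, h w x, h i x, h j x, h k x]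
  | _ => 0

/-- The set of codes of the labelled graphs on five vertices which are isomorphic to a graph in `F`,
as a bit mask. -/
def codeTable (F : List (ℕ → ℕ → Bool)) : ℕ :=
  F.foldr (fun h m => ([0, 1, 2, 3, 4].permutations').foldr
    (fun p m => Nat.lor (Nat.pow 2 (labelCode h p)) m) m) 0

/-- A binary decision tree whose leaves hold lists of adjacency patterns to four vertices. -/
inductive DTree
  | leaf (l : List (Bool × Bool × Bool × Bool))
  | node (l r : DTree)

/-- The subtree for a bit which is `0` or not. -/
noncomputable def DTree.step (t : DTree) (b : ℕ) : DTree :=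
  DTree.rec (fun l => .leaf l) (fun l r _ _ => Nat.rec l (fun _ _ => r) b) t

/-- The node with the subtrees `f false` and `f true`. -/
def DTree.branch (f : Bool → DTree) : DTree := .node (f false) (f true)

/-- All adjacency patterns of a vertex to four vertices. -/
def patterns : List (Bool × Bool × Bool × Bool) :=
  [false, true].flatMap fun a => [false, true].flatMap fun b => [false, true].flatMap fun c =>
    [(a, b, c, false), (a, b, c, true)]

/-- For each graph on `w, i, j, k`, the neighbourhoods on it of a fifth vertex for which the code is
in the table. -/
def killTree (table : ℕ) : DTree :=
  .branch fun wi => .branch fun wj => .branch fun ij => .branch fun wk => .branch fun ik =>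
    .branch fun jk => .leaf <| patterns.filter fun p =>
      bit table (encode [wi, wj, ij, wk, ik, jk, p.1, p.2.1, p.2.2.1, p.2.2.2])

/-! ### Discarding types, all candidates in parallel -/

/-- A placed vertex `i`: the mask `2 ^ i`, its backward neighbourhood `row`, and the sets `pos` and `neg` of
the candidate types which contain `i`, respectively do not. -/
structure Ent where
  mask : ℕ
  row : ℕ
  pos : ℕ
  neg : ℕ

/-- The choice between two numbers. -/
noncomputable def sel (b : Bool) (x y : ℕ) : ℕ := Bool.rec y x b

/-- Add to `bad` the candidate types which have one of the patterns in `l`. -/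
noncomputable def kill (m : Bool → Bool → Bool → ℕ) (pos neg : ℕ)
    (l : List (Bool × Bool × Bool × Bool)) (bad : ℕ) : ℕ :=
  List.rec bad (fun p _ ih =>
    Nat.lor (Nat.land (m p.1 p.2.1 p.2.2.1) (Bool.rec neg pos p.2.2.2)) ih) l

/-- `kill` with the patterns at a leaf of the decision tree. -/
noncomputable def killLeaf (m : Bool → Bool → Bool → ℕ) (pos neg : ℕ) (t : DTree) (bad : ℕ) : ℕ :=
  DTree.rec (fun l => kill m pos neg l bad) (fun _ _ _ _ => bad) t

/-- Add to `bad` the types which are excluded by a fourth vertex in `l`, for three fixed vertices. -/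
noncomputable def loopK (rw ri rj : ℕ) (t : DTree) (m : Bool → Bool → Bool → ℕ) (l : List Ent)
    (bad : ℕ) : ℕ :=
  List.rec bad (fun e _ ih => killLeaf m e.pos e.neg
      (((t.step (Nat.land rw e.mask)).step (Nat.land ri e.mask)).step (Nat.land rj e.mask)) ih) l

/-- Add to `bad` the types which are excluded by two vertices in `l`, for two fixed vertices. -/
noncomputable def loopJ (full rw ri : ℕ) (t : DTree) (m : Bool → Bool → ℕ) (l : List Ent) : ℕ → ℕ :=
  List.rec (fun bad => bad) (fun e es ih bad => Bool.rec (ih (loopK rw ri e.row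
        ((t.step (Nat.land rw e.mask)).step (Nat.land ri e.mask))
        (fun a b c => Nat.land (m a b) (Bool.rec e.neg e.pos c)) es bad)) bad (Nat.beq bad full)) l

/-- Add to `bad` the types which are excluded by three vertices in `l`, for one fixed vertex. -/
noncomputable def loopI (full rw : ℕ) (t : DTree) (m : Bool → ℕ) (l : List Ent) : ℕ → ℕ :=
  List.rec (fun bad => bad) (fun e es ih bad => ih (loopJ full rw e.row
      (t.step (Nat.land rw e.mask)) (fun a b => Nat.land (m a) (Bool.rec e.neg e.pos b)) es bad)) l

/-- The concatenation of the `n`-bit words in a list. -/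
noncomputable def pack (n : ℕ) (T : List ℕ) : ℕ :=
  List.rec 0 (fun t _ ih => Nat.add t (Nat.shiftLeft ih n)) T

/-- The concatenation of the `n`-bit word `1`, as often as the list is long. -/
noncomputable def packOnes (n : ℕ) (T : List ℕ) : ℕ :=
  List.rec 0 (fun _ _ ih => Nat.add 1 (Nat.shiftLeft ih n)) T

/-- The set of the packed words whose bit `i` is set. -/
def col (R M i : ℕ) : ℕ := Nat.land (Nat.shiftRight R i) M

/-- The entries of the placed vertices. -/
noncomputable def ents (R M : ℕ) (A : List ℕ) : List Ent :=
  List.rec [] (fun r A ih =>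
    ⟨Nat.pow 2 A.length, r, col R M A.length, Nat.xor (col R M A.length) M⟩ :: ih) A

/-- The words whose lowest bit in `bad` is not set. -/
noncomputable def dropBad (n : ℕ) (T : List ℕ) : ℕ → List ℕ :=
  List.rec (fun _ => []) (fun t _ ih bad => Nat.rec (t :: ih (Nat.shiftRight bad n))
    (fun _ _ => ih (Nat.shiftRight bad n)) (Nat.land bad 1)) T

/-- The types in `T` which no four vertices exclude, one of them being the last vertex, with row `r`. -/
noncomputable def refuteWith (t : DTree) (n r : ℕ) (A T : List ℕ) (R M c : ℕ) : List ℕ :=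
  dropBad n T (loopI M r t (fun b => sel b c (Nat.xor c M)) (ents R M A) 0)

/-- The types in `T` which no four vertices, one of them the last one, exclude. The list `A` holds the
backward neighbourhoods of the placed vertices, last vertex first. -/
noncomputable def refute (t : DTree) (A T : List ℕ) : List ℕ :=
  match A with
  | [] => T
  | r :: A => refuteWith t (A.length + 1) r A T (pack (A.length + 1) T)
      (packOnes (A.length + 1) T)
      (col (pack (A.length + 1) T) (packOnes (A.length + 1) T) A.length)

/-! ### Rules that force a further vertex, and the certificate checker -/

/-- The neighbourhood of the vertex `a`. -/
noncomputable def nbrs (A : List ℕ) (a : ℕ) : ℕ :=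
  List.rec 0 (fun r A ih => Bool.rec
    (Bool.rec ih (Nat.lor (Nat.pow 2 A.length) ih) (bit r a)) r (Nat.beq A.length a)) A

/-- Reasons for which a critical graph has a further vertex: the vertices `p.1` could be recoloured like
the vertices `p.2`, for `p ∈ ps`; the vertex `u` has degree at most `3`; the placed vertices have the
`4`-colouring `c`. -/
inductive Rule
  | core (ps : List (ℕ × ℕ))
  | deg (u : ℕ)
  | conn (c : ℕ)

/-- The types of the further vertex which the rule provides. -/
def Rule.hit : Rule → ℕ → Bool
  | .core ps, t => ps.any fun p => bit t p.1 && !bit t p.2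
  | .deg u, t => bit t u
  | .conn _, t => !Nat.beq t 0

/-- The set of the first components. -/
def maskOf : List (ℕ × ℕ) → ℕ
  | [] => 0
  | p :: ps => Nat.lor (Nat.pow 2 p.1) (maskOf ps)

/-- The colour of `i` in the colouring with code `c`. -/
def color (c i : ℕ) : ℕ := Nat.land (Nat.shiftRight c (Nat.mul 2 i)) 3

/-- The rule applies to the placed vertices. -/
noncomputable def Rule.valid (A : List ℕ) : Rule → Bool
  | .core ps => !ps.isEmpty && ps.all fun p =>
      Nat.ble (p.1 + 1) A.length && Nat.ble (p.2 + 1) A.length && !bit (maskOf ps) p.2 &&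
      -- Every placed neighbour of `p.1` is moved itself or is a neighbour of `p.2`; hence the
      -- vertex provided by the rule is not a placed one.
      Nat.beq (Nat.land (nbrs A p.1) (Nat.lor (maskOf ps) (nbrs A p.2))) (nbrs A p.1) &&
      ps.all fun q => !bit (nbrs A p.1) q.1 || bit (nbrs A p.2) q.2
  | .deg u => Nat.ble (u + 1) A.length &&
      Nat.ble ((List.range A.length).countP fun i => bit (nbrs A u) i) 3
  | .conn c => !A.isEmpty && (List.range A.length).all fun i => (List.range A.length).all fun j =>
      !bit (nbrs A i) j || !Nat.beq (color c i) (color c j)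

/-- Group the entries of a list in pairs. -/
def pairUp : List ℕ → List (ℕ × ℕ)
  | a :: b :: l => (a, b) :: pairUp l
  | _ => []

/-- The rule with code `c`. -/
def decodeRule (c : ℕ) : Rule := match Nat.mod c 4 with
  | 0 => .deg (Nat.div c 8)
  | 1 => .conn (Nat.div c 8)
  -- The number of pairs is stored in base `4`; the vertices follow as digits in base `32`.
  | _ => .core (pairUp (digitsBelow 32 (2 * Nat.mod (Nat.div c 8) 4) (Nat.div c 32)))

/-- The Boolean graph given by adjacency lists. -/
def listAdj (L : List (List ℕ)) (i j : ℕ) : Bool := (L.getD i []).any (Nat.beq j)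

/-- The vertices `ps` induce a copy of the graph with adjacency lists `L`. -/
noncomputable def isCopyAt (L : List (List ℕ)) (A ps : List ℕ) : Bool :=
  ps.all (fun p => Nat.ble (p + 1) A.length) && decide ps.Nodup &&
  (List.range L.length).all fun i => (List.range L.length).all fun j =>
    listAdj L i j == bit (nbrs A (ps.getD i 0)) (ps.getD j 0)

/-- The placed vertices contain the graph of the list `Ls` which is named by the code `c`. -/
noncomputable def leafOk (Ls : List (List (List ℕ))) (A : List ℕ) (c : ℕ) : Bool :=
  Nat.ble (Nat.mod c 32 + 1) Ls.length &&
  isCopyAt (Ls.getD (Nat.mod c 32) []) A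
    (digitsBelow 32 (Ls.getD (Nat.mod c 32) []).length (Nat.div c 32))

/-- The two extensions of each type by a new vertex `n`. -/
def double (n : ℕ) (T : List ℕ) : List ℕ := T ++ T.map fun t => Nat.add t (Nat.pow 2 n)

/-- Run the checker `k` on all extensions by a vertex whose type is in the list, one after the other;
a type that is done with is no longer a candidate for later vertices. -/
noncomputable def children (k : List ℕ → List ℕ → List ℕ → Option (List ℕ)) (A : List ℕ) :
    List ℕ → List ℕ → List ℕ → Option (List ℕ)
  | [], _, h => some h
  | s :: S, T, h => match k (s :: A) (double A.length T) h with
    | none => none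
    | some h' => children k A S (T.filter fun t => !Nat.beq t s) h'

/-- The certificate checker: at each node, the hint names a graph in `Ls` which has been found, or a rule
which provides a further vertex. The result is the list of the unused hints. -/
noncomputable def check (t : DTree) (Ls : List (List (List ℕ))) :
    ℕ → List ℕ → List ℕ → List ℕ → Option (List ℕ)
  | 0, _, _, _ => none
  | _ + 1, _, _, [] => none
  -- The remainder `3` modulo `4` marks a listed graph; the other remainders select the kind of
  -- rule.
  | k + 1, A, T, c :: h => match Nat.beq (Nat.mod c 4) 3 with
    | true => match leafOk Ls A (Nat.div c 4) with
      | true => some h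
      | false => none
    | false => match (decodeRule c).valid A with
      | false => none
      -- Bit `2` announces that no type hit by the rule survives. Then only those types need to be
      -- tested, not all of `T`.
      | true => match bit c 2 with
        | true => match refute t A (T.filter (decodeRule c).hit) with
          | [] => some h
          | _ :: _ => none
        | false =>
          children (check t Ls k) A ((refute t A T).filter (decodeRule c).hit) (refute t A T) h

/-- The types of further vertices which are not excluded by the placed vertices. -/
noncomputable def typesOf (t : DTree) : List ℕ → List ℕ
  | [] => [0]
  | s :: A => refute t (s :: A) (double A.length (typesOf t A))

/-- The path with vertices `0, …, 4`, in order. -/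
def pathAdj (i j : ℕ) : Bool := Nat.beq (i + 1) j || Nat.beq (j + 1) i

/-- The gem. -/
def gemAdj (i j : ℕ) : Bool :=
  !Nat.beq i j && (Nat.beq i 4 || Nat.beq j 4 || Nat.beq (i + 1) j || Nat.beq (j + 1) i)

/-- The complement of the disjoint union of the paths `0 - 1 - 2` and `3 - 4`. -/
def coAdj (i j : ℕ) : Bool := !Nat.beq i j && !(Nat.ble i 2 && Nat.ble j 2 && pathAdj i j) &&
   !(Nat.ble 3 i && Nat.ble 3 j)

/-- The cycle with vertices `0, …, 4`, in order. -/
def cycAdj (i j : ℕ) : Bool := pathAdj i j || pathAdj (i + 5) j || pathAdj i (j + 5)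

/-- The complete graph. -/
def complAdj (i j : ℕ) : Bool := !Nat.beq i j

/-! ### Recolouring arguments in critical graphs -/

section Critical

variable {V : Type*} {G : SimpleGraph V}

/-- `G` is not `4`-colourable, but all its vertex-deleted subgraphs are. -/
structure IsCritical (G : SimpleGraph V) : Prop where
  not_colorable : ¬ G.Colorable 4
  induce_colorable (v : V) : (G.induce {v}ᶜ).Colorable 4

/-- A partial `4`-colouring of `G` which is proper away from `v`. -/
theorem IsCritical.exists_coloring (hG : IsCritical G) (v : V) :
    ∃ c : V → Fin 4, ∀ x y, x ≠ v → y ≠ v → G.Adj x y → c x ≠ c y := by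
  obtain ⟨c⟩ := hG.induce_colorable v
  classical
  refine ⟨fun x => if h : x = v then 0 else c ⟨x, h⟩, fun x y hx hy hxy => ?_⟩
  simp only [hx, hy, dite_false]
  exact c.valid (by simpa using hxy)

theorem IsCritical.false_of_coloring (hG : IsCritical G) (c : V → Fin 4)
    (hc : ∀ x y, G.Adj x y → c x ≠ c y) : False :=
  hG.not_colorable ⟨SimpleGraph.Coloring.mk c fun {x y} h => hc x y h⟩

/-- A deleted vertex can be given a fifth colour, here `none`. -/
theorem IsCritical.colorable_five (hG : IsCritical G) : G.Colorable 5 := by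
  by_cases hV : Nonempty V
  · obtain ⟨v⟩ := hV
    obtain ⟨c, hc⟩ := hG.exists_coloring v
    classical
    let d : G.Coloring (Option (Fin 4)) :=
      SimpleGraph.Coloring.mk (fun x => if x = v then none else some (c x)) (by
        intro x y hxy
        by_cases hx : x = v
        · subst hx
          simp [hxy.ne']
        · by_cases hy : y = v
          · simp [hx, hy]
          · simpa [hx, hy] using hc x y hx hy hxy)
    simpa using d.colorable
  · rw [not_nonempty_iff] at hV
    exact (hG.false_of_coloring isEmptyElim fun x => isEmptyElim x).elim

/-- The upper bound on the chromatic number is automatic by `IsCritical.colorable_five`, so only the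
failure of `4`-colourability matters. -/
theorem isVertexCritical_five_iff : IsVertexCritical 5 G ↔ IsCritical G := by
  have key : ∀ {W : Type _} (H : SimpleGraph W), H.chromaticNumber < (5 : ℕ) ↔ H.Colorable 4 := by
    intro W H
    rw [← SimpleGraph.chromaticNumber_le_iff_colorable]
    exact ENat.lt_add_one_iff (n := 4) (ENat.natCast_ne_top 4)
  constructor
  · rintro ⟨h1, h2⟩
    refine ⟨fun h => ?_, fun v => (key _).1 (h2 v)⟩
    have := (key G).2 h
    rw [h1] at this
    exact lt_irrefl _ this
  · intro h
    refine ⟨le_antisymm ?_ ?_, fun v => (key _).2 (h.induce_colorable v)⟩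
    · exact SimpleGraph.chromaticNumber_le_iff_colorable.2 h.colorable_five
    · exact not_lt.1 fun h' => h.not_colorable ((key G).1 h')

/-- A critical graph has no retraction onto a proper subgraph: here the set `S` is moved by `φ`. -/
theorem IsCritical.exists_adj_not_adj (hG : IsCritical G) (S : Set V) (hS : S.Nonempty)
    (φ : V → V) (hφ : ∀ a ∈ S, φ a ∉ S)
    (hE : ∀ a ∈ S, ∀ b ∈ S, G.Adj a b → G.Adj (φ a) (φ b)) :
    ∃ v ∉ S, ∃ a ∈ S, G.Adj v a ∧ ¬ G.Adj v (φ a) := by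
  by_contra! H
  obtain ⟨s, hs⟩ := hS
  obtain ⟨c, hc⟩ := hG.exists_coloring s
  classical
  have hne : ∀ {x}, x ∉ S → x ≠ s := fun hx h => hx (h ▸ hs)
  -- The colouring `c` is unreliable only at `s`, and `s` is in `S` while `φ` leaves `S`; so the
  -- colour of `s` is never used.
  refine hG.false_of_coloring (fun x => if x ∈ S then c (φ x) else c x) fun x y hxy => ?_
  by_cases hx : x ∈ S <;> by_cases hy : y ∈ S <;> simp only [hx, hy, if_true, if_false]
  · exact hc _ _ (hne (hφ x hx)) (hne (hφ y hy)) (hE x hx y hy hxy)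
  · exact hc _ _ (hne (hφ x hx)) (hne hy) (H y hy x hx hxy.symm).symm
  · exact hc _ _ (hne hx) (hne (hφ y hy)) (H x hx y hy hxy)
  · exact hc _ _ (hne hx) (hne hy) hxy

/-- If all neighbours of `u` were in `N`, they would use at most three colours in a colouring of `G
- u`, and the fourth would be free for `u`. -/
theorem IsCritical.exists_adj_notMem (hG : IsCritical G) (u : V) (N : Finset V) (hN : N.card ≤ 3) :
    ∃ v ∉ N, G.Adj u v := by
  by_contra! H
  obtain ⟨c, hc⟩ := hG.exists_coloring u
  classical
  obtain ⟨k, hk⟩ : ∃ k, k ∉ N.image c := by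
    by_contra! h
    have : (Finset.univ : Finset (Fin 4)) ⊆ N.image c := fun x _ => h x
    have := (Finset.card_le_card this).trans Finset.card_image_le
    simp at this
    omega
  have hk' : ∀ y, G.Adj u y → c y ≠ k := fun y hy h =>
    hk (Finset.mem_image.2 ⟨y, by by_contra h'; exact H y h' hy, h⟩)
  refine hG.false_of_coloring (fun x => if x = u then k else c x) fun x y hxy => ?_
  by_cases hx : x = u <;> by_cases hy : y = u <;> simp only [hx, hy, if_true, if_false]
  · exact (hxy.ne (hx.trans hy.symm)).elim
  · exact (hk' y (hx ▸ hxy)).symm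
  · exact hk' x (hy ▸ hxy.symm)
  · exact hc _ _ hx hy hxy

/-- A proper nonempty `4`-colourable set of vertices has a neighbour outside. -/
theorem IsCritical.exists_adj_outside (hG : IsCritical G) (S : Set V) (hS : S.Nonempty)
    (d : V → Fin 4) (hd : ∀ x ∈ S, ∀ y ∈ S, G.Adj x y → d x ≠ d y) :
    ∃ v ∉ S, ∃ a ∈ S, G.Adj v a := by
  by_contra! H
  obtain ⟨s, hs⟩ := hS
  obtain ⟨c, hc⟩ := hG.exists_coloring s
  classical
  have hne : ∀ {x}, x ∉ S → x ≠ s := fun hx h => hx (h ▸ hs)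
  -- Without edges between `S` and its complement, the colouring `d` of `S` and a colouring of `G -
  -- s` can be glued.
  refine hG.false_of_coloring (fun x => if x ∈ S then d x else c x) fun x y hxy => ?_
  by_cases hx : x ∈ S <;> by_cases hy : y ∈ S <;> simp only [hx, hy, if_true, if_false]
  · exact hd x hx y hy hxy
  · exact (H y hy x hx hxy.symm).elim
  · exact (H x hx y hy hxy).elim
  · exact hc _ _ (hne hx) (hne hy) hxy

end Critical

/-! ### From codes to induced five-vertex subgraphs -/

section Copies

variable {V : Type*} {G : SimpleGraph V}

/-- `g` embeds the Boolean graph `h` on `{0, …, k - 1}` as an induced subgraph of `G`. -/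
def IsCopy (G : SimpleGraph V) (k : ℕ) (h : ℕ → ℕ → Bool) (g : ℕ → V) : Prop :=
  (∀ i < k, ∀ j < k, g i = g j → i = j) ∧ ∀ i < k, ∀ j < k, (G.Adj (g i) (g j) ↔ h i j = true)

theorem bit_eq (t i : ℕ) : bit t i = t.testBit i := by
  have h2 : Nat.land (Nat.shiftRight t i) 1 = (t >>> i) % 2 := Nat.and_one_is_mod _
  rw [bit, h2, Nat.testBit_eq_decide_div_mod_eq, Nat.shiftRight_eq_div_pow]
  rcases Nat.mod_two_eq_zero_or_one (t / 2 ^ i) with h | h <;> rw [h] <;> rfl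

/-- Decision trees and copy searches branch on whether such a masked number vanishes; this is the
test of a single bit. -/
theorem land_two_pow_beq (r i : ℕ) : (!Nat.beq (Nat.land r (Nat.pow 2 i)) 0) = bit r i := by
  have h : Nat.land r (Nat.pow 2 i) = (r.testBit i).toNat * 2 ^ i := Nat.and_two_pow r i
  rw [h, bit_eq]
  cases r.testBit i
  · simp
  · have : Nat.beq (2 ^ i) 0 = false := Bool.eq_false_iff.2 fun h' => by
      simpa using Nat.eq_of_beq_eq_true h'
    simp [this]

/-- Equal lengths are needed, because trailing `false` digits do not change the number. -/
theorem encode_injective :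
    ∀ {l l' : List Bool}, l.length = l'.length → encode l = encode l' → l = l'
  | [], [], _, _ => rfl
  | a :: l, b :: l', h, e => by
    have key : encode l = encode l' ∧ a = b := by
      cases a <;> cases b <;> simp only [encode, Nat.add_eq, Nat.mul_eq] at e <;> simp <;> omega
    rw [key.2, encode_injective (by simpa using h) key.1]

/-- The Boolean graph is symmetric and irreflexive. -/
structure IsSimple (h : ℕ → ℕ → Bool) : Prop where
  symm (i j : ℕ) : h i j = h j i
  irrefl (i : ℕ) : h i i = false

theorem exists_of_bit_codeTable {F : List (ℕ → ℕ → Bool)} {n : ℕ}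
    (hn : bit (codeTable F) n = true) :
    ∃ h ∈ F, ∃ p : List ℕ, p.Perm [0, 1, 2, 3, 4] ∧ n = labelCode h p := by
  -- The inner fold inserts the labellings of one graph into the mask `m` of the graphs treated
  -- before.
  have inner : ∀ (h : ℕ → ℕ → Bool) (P : List (List ℕ)) (m : ℕ),
      (P.foldr (fun p m => Nat.lor (Nat.pow 2 (labelCode h p)) m) m).testBit n = true →
      m.testBit n = true ∨ ∃ p ∈ P, n = labelCode h p := by
    intro h P m
    induction P with
    | nil => exact Or.inl
    | cons p P ih =>
      intro H
      have H' : (2 ^ labelCode h p |||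
        P.foldr (fun p m => Nat.lor (Nat.pow 2 (labelCode h p)) m) m).testBit n = true := H
      rw [Nat.testBit_or, Bool.or_eq_true, Nat.testBit_two_pow, decide_eq_true_iff] at H'
      rcases H' with H' | H'
      · exact Or.inr ⟨p, by simp, H'.symm⟩
      · rcases ih H' with h1 | ⟨q, hq, h1⟩
        · exact Or.inl h1
        · exact Or.inr ⟨q, by simp [hq], h1⟩
  rw [bit_eq] at hn
  induction F with
  | nil => simp [codeTable] at hn
  | cons h F ih =>
    rcases inner h _ _ hn with h1 | ⟨p, hp, h1⟩
    · obtain ⟨h', hh', r⟩ := ih h1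
      exact ⟨h', by simp [hh'], r⟩
    · exact ⟨h, by simp, p, List.mem_permutations'.1 hp, h1⟩

/-- Five vertices whose code is in the table form a copy of a graph in `F`. -/
theorem exists_copy_of_code {F : List (ℕ → ℕ → Bool)} (hF : ∀ h ∈ F, IsSimple h)
    {w i j k x : V} (hne : [w, i, j, k, x].Nodup) {wi wj ij wk ik jk xw xi xj xk : Bool}
    (hwi : G.Adj w i ↔ wi = true) (hwj : G.Adj w j ↔ wj = true) (hij : G.Adj i j ↔ ij = true)
    (hwk : G.Adj w k ↔ wk = true) (hik : G.Adj i k ↔ ik = true) (hjk : G.Adj j k ↔ jk = true)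
    (hxw : G.Adj x w ↔ xw = true) (hxi : G.Adj x i ↔ xi = true) (hxj : G.Adj x j ↔ xj = true)
    (hxk : G.Adj x k ↔ xk = true)
    (hc : bit (codeTable F) (encode [wi, wj, ij, wk, ik, jk, xw, xi, xj, xk]) = true) :
    ∃ h ∈ F, ∃ g, IsCopy G 5 h g := by
  obtain ⟨h, hh, p, hp, he⟩ := exists_of_bit_codeTable hc
  refine ⟨h, hh, ?_⟩
  have hs := (hF h hh).symm
  have hi := (hF h hh).irrefl
  obtain ⟨a, b, c, d, e, rfl⟩ : ∃ a b c d e, p = [a, b, c, d, e] := by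
    have := hp.length_eq
    rcases p with _ | ⟨a, _ | ⟨b, _ | ⟨c, _ | ⟨d, _ | ⟨e, _ | ⟨y, p⟩⟩⟩⟩⟩⟩ <;> simp at this
    exact ⟨a, b, c, d, e, rfl⟩
  have hnd : [a, b, c, d, e].Nodup := hp.nodup_iff.2 (by decide)
  have hmem : ∀ n < 5, n = a ∨ n = b ∨ n = c ∨ n = d ∨ n = e := by
    intro n hn
    have : n ∈ [a, b, c, d, e] := hp.mem_iff.2 (by simp; omega)
    simpa using this
  simp only [labelCode] at he
  have hcode := encode_injective (by rfl) he
  simp only [List.cons.injEq, and_true] at hcode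
  obtain ⟨rfl, rfl, rfl, rfl, rfl, rfl, rfl, rfl, rfl, rfl⟩ := hcode
  simp only [List.nodup_cons, List.mem_cons, List.not_mem_nil, or_false, not_or, List.nodup_nil,
    and_true, not_false_eq_true] at hnd hne
  obtain ⟨⟨ab, ac, ad, ae⟩, ⟨bc, bd, be⟩, ⟨cd, ce⟩, de⟩ := hnd
  obtain ⟨⟨n1, n2, n3, n4⟩, ⟨n5, n6, n7⟩, ⟨n8, n9⟩, n10⟩ := hne
  -- The list `[a, b, c, d, e]` gives the labels of `w, i, j, k, x`, and `g` inverts this labelling;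
  -- the final default serves `e`.
  let g : ℕ → V := fun n => if n = a then w else if n = b then i else if n = c then j else
    if n = d then k else x
  have ga : g a = w := by simp [g]
  have gb : g b = i := by simp [g, Ne.symm ab]
  have gc : g c = j := by simp [g, Ne.symm ac, Ne.symm bc]
  have gd : g d = k := by simp [g, Ne.symm ad, Ne.symm bd, Ne.symm cd]
  have ge : g e = x := by simp [g, Ne.symm ae, Ne.symm be, Ne.symm ce, Ne.symm de]
  refine ⟨g, fun m hm n hn => ?_, fun m hm n hn => ?_⟩
  · rcases hmem m hm with rfl | rfl | rfl | rfl | rfl <;>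
    rcases hmem n hn with rfl | rfl | rfl | rfl | rfl <;>
    simp only [ga, gb, gc, gd, ge] <;> intro H <;>
    first | trivial | exact absurd H ‹_› | exact absurd H.symm ‹_›
  · rcases hmem m hm with rfl | rfl | rfl | rfl | rfl <;>
    rcases hmem n hn with rfl | rfl | rfl | rfl | rfl <;>
    simp only [ga, gb, gc, gd, ge, SimpleGraph.irrefl, hi, Bool.false_eq_true] <;>
    first
    | assumption
    | (rw [G.adj_comm]; assumption)
    | (rw [hs]; assumption)
    | (rw [G.adj_comm, hs]; assumption)

end Copies

/-! ### Packed words -/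

theorem testBit_lor (a b p : ℕ) : (Nat.lor a b).testBit p = (a.testBit p || b.testBit p) :=
  Nat.testBit_or a b p

theorem testBit_land (a b p : ℕ) : (Nat.land a b).testBit p = (a.testBit p && b.testBit p) :=
  Nat.testBit_and a b p

theorem testBit_xor (a b p : ℕ) : (Nat.xor a b).testBit p = (a.testBit p ^^ b.testBit p) :=
  Nat.testBit_xor a b p

theorem testBit_shiftRight (a b p : ℕ) : (Nat.shiftRight a b).testBit p = a.testBit (b + p) :=
  Nat.testBit_shiftRight a

section Packing

/-- The word `t` fits into the lowest `n` bits, so the addition has no carries. -/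
theorem testBit_add_shiftLeft {n t : ℕ} (ht : t < 2 ^ n) (R p : ℕ) :
    (Nat.add t (Nat.shiftLeft R n)).testBit p =
      if p < n then t.testBit p else R.testBit (p - n) := by
  have : Nat.add t (Nat.shiftLeft R n) = 2 ^ n * R + t := by
    rw [Nat.add_eq, show Nat.shiftLeft R n = R <<< n from rfl, Nat.shiftLeft_eq]
    ring
  rw [this, Nat.testBit_two_pow_mul_add _ ht]

theorem testBit_pack {n : ℕ} : ∀ (T : List ℕ), (∀ t ∈ T, t < 2 ^ n) → ∀ (q : ℕ) (hq : q < T.length),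
    ∀ i < n, (pack n T).testBit (n * q + i) = T[q].testBit i
  | [], _, q, hq, _, _ => absurd hq (by simp)
  | t :: T, hT, q, hq, i, hi => by
    rw [show pack n (t :: T) = Nat.add t (Nat.shiftLeft (pack n T) n) from rfl,
      testBit_add_shiftLeft (hT t (by simp))]
    cases q with
    | zero => simp [hi]
    | succ q =>
      have : n * (q + 1) + i - n = n * q + i := by rw [Nat.mul_succ]; omega
      rw [if_neg (by rw [Nat.mul_succ]; omega), this,
        testBit_pack T (fun t ht => hT t (by simp [ht])) q (by simpa using hq) i hi]
      simp

theorem testBit_packOnes {n : ℕ} (hn : 0 < n) : ∀ (T : List ℕ) (q : ℕ), q < T.length →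
    (packOnes n T).testBit (n * q) = true
  | [], q, hq => absurd hq (by simp)
  | t :: T, q, hq => by
    rw [show packOnes n (t :: T) = Nat.add 1 (Nat.shiftLeft (packOnes n T) n) from rfl,
      testBit_add_shiftLeft (Nat.one_lt_two_pow hn.ne')]
    cases q with
    | zero => simp [hn]
    | succ q =>
      have : n * (q + 1) - n = n * q := by rw [Nat.mul_succ]; omega
      rw [if_neg (by rw [Nat.mul_succ]; omega), this,
        testBit_packOnes hn T q (by simpa using hq)]

/-- The verdict on word `q` is the lowest bit of its block, in position `n * q`; the other bits of
`bad` are ignored. -/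
theorem getElem_mem_dropBad (n : ℕ) : ∀ (T : List ℕ) (bad q : ℕ) (hq : q < T.length),
    bad.testBit (n * q) = false → T[q] ∈ dropBad n T bad
  | [], _, q, hq, _ => absurd hq (by simp)
  | t :: T, bad, q, hq, hb => by
    have e : dropBad n (t :: T) bad = Nat.rec (t :: dropBad n T (Nat.shiftRight bad n))
      (fun _ _ => dropBad n T (Nat.shiftRight bad n)) (Nat.land bad 1) := rfl
    rw [e, show Nat.land bad 1 = bad % 2 from Nat.and_one_is_mod _]
    cases q with
    | zero =>
      have : bad % 2 = 0 := by simpa using hb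
      rw [this]
      simp
    | succ q =>
      have ih := getElem_mem_dropBad n T (Nat.shiftRight bad n) q (by simpa using hq) (by
        rw [testBit_shiftRight, ← hb, Nat.mul_succ, Nat.add_comm])
      rcases Nat.mod_two_eq_zero_or_one bad with h | h <;> rw [h]
      · simpa using Or.inr ih
      · simpa using ih

end Packing

/-! ### Only impossible types are discarded -/

section Refute

variable {V : Type*} {G : SimpleGraph V}

/-- The vertices `f 0, f 1, …` induce the graph whose lower triangular adjacency rows are `A`,
the row of the last vertex coming first. -/
def Placed (G : SimpleGraph V) : List ℕ → (ℕ → V) → Prop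
  | [], _ => True
  | r :: A, f => Placed G A f ∧ (∀ j < A.length, f A.length ≠ f j) ∧
      (∀ j < A.length, (G.Adj (f A.length) (f j) ↔ bit r j = true)) ∧ r < 2 ^ A.length

/-- The bits of `t` describe the neighbourhood of `v` on `f 0, …, f (n - 1)`. -/
def HasType (G : SimpleGraph V) (n : ℕ) (f : ℕ → V) (v : V) (t : ℕ) : Prop :=
  ∀ i < n, (G.Adj v (f i) ↔ bit t i = true)

theorem step_branch (F : Bool → DTree) (b : ℕ) :
    (DTree.branch F).step b = F (!Nat.beq b 0) := by
  cases b <;> rfl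

/-- Position `p` stands for one candidate type. A pattern marks it only if the type agrees with the
pattern on the first three vertices, which is recorded by `m`, and on the fourth, recorded by `pos`
or `neg`. -/
theorem testBit_kill {m : Bool → Bool → Bool → ℕ} {pos neg p : ℕ}
    {l : List (Bool × Bool × Bool × Bool)} {bad : ℕ} (hb : bad.testBit p = false)
    (H : ∀ q ∈ l, (m q.1 q.2.1 q.2.2.1).testBit p = true →
      (bif q.2.2.2 then pos else neg).testBit p = true → False) :
    (kill m pos neg l bad).testBit p = false := by
  induction l with
  | nil => exact hb
  | cons q l ih =>
    have e : kill m pos neg (q :: l) bad =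
      Nat.lor (Nat.land (m q.1 q.2.1 q.2.2.1) (Bool.rec neg pos q.2.2.2)) (kill m pos neg l bad) := rfl
    rw [e, testBit_lor, ih fun q hq => H q (by simp [hq]), testBit_land, Bool.or_false,
      ← Bool.not_eq_true, Bool.and_eq_true]
    rintro ⟨h1, h2⟩
    exact H q (by simp) h1 (by cases h : q.2.2.2 <;> simpa [h] using h2)

variable {F : List (ℕ → ℕ → Bool)} {f : ℕ → V} {v : V} {R M p : ℕ}

/-- In position `p`, the columns of the packed types describe the neighbourhood of `v`. -/
def ColsOk (G : SimpleGraph V) (n : ℕ) (f : ℕ → V) (v : V) (R M p : ℕ) : Prop :=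
  ∀ i < n, ((col R M i).testBit p = true → G.Adj v (f i)) ∧
    ((Nat.xor (col R M i) M).testBit p = true → ¬ G.Adj v (f i))

theorem ColsOk.sel {n : ℕ} (h : ColsOk G n f v R M p) {i : ℕ} (hi : i < n) {b : Bool}
    (hb : (bif b then col R M i else Nat.xor (col R M i) M).testBit p = true) :
    G.Adj v (f i) ↔ b = true := by
  cases b
  · simpa using (h i hi).2 hb
  · simpa using (h i hi).1 hb

/-- If the position of the type of `v` were marked, then `w`, `i`, `j`, a further placed vertex and
`v` would have a code in the table, and would form a forbidden graph by `exists_copy_of_code`. The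
tree has already been descended along the edges among `w`, `i`, `j`; three levels remain for the
fourth vertex. -/
theorem testBit_loopK (hF : ∀ h ∈ F, IsSimple h) (hG : ∀ h ∈ F, ¬ ∃ g, IsCopy G 5 h g)
    {w i j : V} {wi wj ij : Bool}
    (hwi : G.Adj w i ↔ wi = true) (hwj : G.Adj w j ↔ wj = true) (hij : G.Adj i j ↔ ij = true)
    (hne : [w, i, j, v].Nodup) {rw ri rj : ℕ} {m : Bool → Bool → Bool → ℕ}
    (hm : ∀ a b c, (m a b c).testBit p = true → (G.Adj v w ↔ a = true) ∧ (G.Adj v i ↔ b = true) ∧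
      (G.Adj v j ↔ c = true)) :
    ∀ {A : List ℕ}, Placed G A f → ColsOk G A.length f v R M p →
      (∀ k < A.length, f k ∉ [w, i, j, v]) →
      (∀ k < A.length, (G.Adj w (f k) ↔ bit rw k = true) ∧ (G.Adj i (f k) ↔ bit ri k = true) ∧
        (G.Adj j (f k) ↔ bit rj k = true)) →
      ∀ {bad : ℕ}, bad.testBit p = false →
      (loopK rw ri rj (.branch fun wk => .branch fun ik => .branch fun jk => .leaf <|
        patterns.filter fun q => bit (codeTable F)
          (encode [wi, wj, ij, wk, ik, jk, q.1, q.2.1, q.2.2.1, q.2.2.2])) m (ents R M A) bad).testBit p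
        = false
  | [], _, _, _, _, _, hb => hb
  | r :: A, hA, hC, hf, hr, bad, hb => by
    have ih := testBit_loopK hF hG hwi hwj hij hne hm hA.1
      (fun i hi => hC i (by simp; omega)) (fun k hk => hf k (by simp; omega))
      (fun k hk => hr k (by simp; omega)) hb
    rw [show ∀ t, loopK rw ri rj t m (ents R M (r :: A)) bad = killLeaf m (col R M A.length)
      (Nat.xor (col R M A.length) M) (((t.step (Nat.land rw (Nat.pow 2 A.length))).step
        (Nat.land ri (Nat.pow 2 A.length))).step (Nat.land rj (Nat.pow 2 A.length)))
        (loopK rw ri rj t m (ents R M A) bad) from fun _ => rfl, step_branch, step_branch,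
        step_branch, land_two_pow_beq, land_two_pow_beq, land_two_pow_beq]
    refine testBit_kill ih ?_
    intro q hq h1 h2
    obtain ⟨h3, h4, h5⟩ := hm _ _ _ h1
    have h6 := hC.sel (i := A.length) (by simp) h2
    obtain ⟨h7, h8, h9⟩ := hr A.length (by simp)
    obtain ⟨h, hh, hg⟩ := exists_copy_of_code (G := G) hF (w := w) (i := i) (j := j)
      (k := f A.length) (x := v) (by
        have := hf A.length (by simp)
        simp only [List.nodup_cons, List.mem_cons, List.not_mem_nil, or_false, not_or,
          List.nodup_nil, and_true, not_false_eq_true] at this hne ⊢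
        grind) hwi hwj hij h7 h8 h9 h3 h4 h5 h6 (List.mem_filter.1 hq).2
    exact hG h hh hg

theorem testBit_loopJ (hF : ∀ h ∈ F, IsSimple h) (hG : ∀ h ∈ F, ¬ ∃ g, IsCopy G 5 h g)
    {w i : V} {wi : Bool} (hwi : G.Adj w i ↔ wi = true) (hne : [w, i, v].Nodup) {full rw ri : ℕ}
    {m : Bool → Bool → ℕ}
    (hm : ∀ a b, (m a b).testBit p = true → (G.Adj v w ↔ a = true) ∧ (G.Adj v i ↔ b = true)) :
    ∀ {A : List ℕ}, Placed G A f → ColsOk G A.length f v R M p →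
      (∀ k < A.length, f k ∉ [w, i, v]) →
      (∀ k < A.length, (G.Adj w (f k) ↔ bit rw k = true) ∧ (G.Adj i (f k) ↔ bit ri k = true)) →
      ∀ {bad : ℕ}, bad.testBit p = false →
      (loopJ full rw ri (.branch fun wj => .branch fun ij =>
        .branch fun wk => .branch fun ik => .branch fun jk => .leaf <|
        patterns.filter fun q => bit (codeTable F)
          (encode [wi, wj, ij, wk, ik, jk, q.1, q.2.1, q.2.2.1, q.2.2.2])) m (ents R M A) bad).testBit p
        = false
  | [], _, _, _, _, _, hb => hb
  | r :: A, hA, hC, hf, hr, bad, hb => by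
    have hC' : ColsOk G A.length f v R M p := fun i hi => hC i (by simp; omega)
    have ih := fun {bad} => testBit_loopJ hF hG hwi hne (full := full) hm hA.1 hC'
      (fun k hk => hf k (by simp; omega)) (fun k hk => hr k (by simp; omega)) (bad := bad)
    rw [show ∀ t, loopJ full rw ri t m (ents R M (r :: A)) bad =
      Bool.rec (loopJ full rw ri t m (ents R M A) (loopK rw ri r
        ((t.step (Nat.land rw (Nat.pow 2 A.length))).step (Nat.land ri (Nat.pow 2 A.length)))
        (fun a b c => Nat.land (m a b) (Bool.rec (Nat.xor (col R M A.length) M) (col R M A.length) c))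
        (ents R M A) bad)) bad (Nat.beq bad full) from fun _ => rfl]
    -- The loop stops as soon as every candidate is marked; then `bad` is returned unchanged.
    cases Nat.beq bad full
    · refine ih ?_
      rw [step_branch, step_branch, land_two_pow_beq, land_two_pow_beq]
      obtain ⟨h1, h2⟩ := hr A.length (by simp)
      have h3 := hf A.length (by simp)
      refine testBit_loopK hF hG hwi h1 h2 (i := i) (j := f A.length) ?_ ?_ hA.1 hC' ?_ ?_ hb
      · simp only [List.nodup_cons, List.mem_cons, List.not_mem_nil, or_false, not_or,
          List.nodup_nil, and_true, not_false_eq_true] at h3 hne ⊢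
        grind
      · intro a b c h
        rw [testBit_land, Bool.and_eq_true] at h
        exact ⟨(hm a b h.1).1, (hm a b h.1).2, hC.sel (i := A.length) (by simp)
          (by cases c <;> exact h.2)⟩
      · intro k hk
        have h4 := hf k (by simp; omega)
        have h5 := hA.2.1 k hk
        simp only [List.mem_cons, List.not_mem_nil, or_false, not_or] at h4 ⊢
        exact ⟨h4.1, h4.2.1, h5.symm, h4.2.2⟩
      · intro k hk
        have h4 := hr k (by simp; omega)
        exact ⟨h4.1, h4.2, hA.2.2.1 k hk⟩
    · exact hb

/-- Here `w` is the vertex placed last. Quadruples without it need not be examined again, and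
soundness does not depend on examining all of them. -/
theorem testBit_loopI (hF : ∀ h ∈ F, IsSimple h) (hG : ∀ h ∈ F, ¬ ∃ g, IsCopy G 5 h g)
    {w : V} (hne : w ≠ v) {full rw : ℕ} {m : Bool → ℕ}
    (hm : ∀ a, (m a).testBit p = true → (G.Adj v w ↔ a = true)) :
    ∀ {A : List ℕ}, Placed G A f → ColsOk G A.length f v R M p →
      (∀ k < A.length, f k ∉ [w, v]) → (∀ k < A.length, (G.Adj w (f k) ↔ bit rw k = true)) →
      ∀ {bad : ℕ}, bad.testBit p = false →
      (loopI full rw (killTree (codeTable F)) m (ents R M A) bad).testBit p = false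
  | [], _, _, _, _, _, hb => hb
  | r :: A, hA, hC, hf, hr, bad, hb => by
    have hC' : ColsOk G A.length f v R M p := fun i hi => hC i (by simp; omega)
    have ih := fun {bad} => testBit_loopI hF hG hne (full := full) hm hA.1 hC'
      (fun k hk => hf k (by simp; omega)) (fun k hk => hr k (by simp; omega)) (bad := bad)
    rw [show ∀ t, loopI full rw t m (ents R M (r :: A)) bad =
      loopI full rw t m (ents R M A) (loopJ full rw r (t.step (Nat.land rw (Nat.pow 2 A.length)))
        (fun a b => Nat.land (m a) (Bool.rec (Nat.xor (col R M A.length) M) (col R M A.length) b))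
        (ents R M A) bad) from fun _ => rfl]
    refine ih ?_
    rw [killTree, step_branch, land_two_pow_beq]
    have h3 := hf A.length (by simp)
    refine testBit_loopJ hF hG (hr A.length (by simp)) ?_ ?_ hA.1 hC' ?_ ?_ hb
    · simp only [List.nodup_cons, List.mem_cons, List.not_mem_nil, or_false, not_or,
        List.nodup_nil, and_true, not_false_eq_true] at h3 ⊢
      grind
    · intro a b h
      rw [testBit_land, Bool.and_eq_true] at h
      exact ⟨hm a h.1, hC.sel (i := A.length) (by simp) (by cases b <;> exact h.2)⟩
    · intro k hk
      have h4 := hf k (by simp; omega)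
      have h5 := hA.2.1 k hk
      simp only [List.mem_cons, List.not_mem_nil, or_false, not_or] at h4 ⊢
      exact ⟨h4.1, h5.symm, h4.2⟩
    · intro k hk
      exact ⟨hr k (by simp; omega), hA.2.2.1 k hk⟩

/-- The type of a vertex is never refuted. -/
theorem mem_refute (hF : ∀ h ∈ F, IsSimple h) (hG : ∀ h ∈ F, ¬ ∃ g, IsCopy G 5 h g)
    {A T : List ℕ} (hA : Placed G A f) (hT : ∀ t ∈ T, t < 2 ^ A.length) {t : ℕ} (ht : t ∈ T)
    (hv : ∀ i < A.length, v ≠ f i) (htv : HasType G A.length f v t) :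
    t ∈ refute (killTree (codeTable F)) A T := by
  rcases A with _ | ⟨r, A⟩
  · exact ht
  obtain ⟨q, hq, rfl⟩ := List.mem_iff_getElem.1 ht
  have hn : 0 < A.length + 1 := by omega
  -- Block `q` starts at position `(A.length + 1) * q`, and the shift in `col` brings bit `i` of
  -- every block to its start. The mask `packOnes` keeps only the starts.
  have hC : ColsOk G (A.length + 1) f v (pack (A.length + 1) T) (packOnes (A.length + 1) T)
      ((A.length + 1) * q) := by
    intro i hi
    have h1 := htv i hi
    rw [bit_eq, ← testBit_pack T hT q hq i hi] at h1
    have h2 := testBit_packOnes hn T q hq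
    rw [testBit_xor, col, testBit_land, testBit_shiftRight, h2, Nat.add_comm i, h1]
    constructor <;> simp
  refine getElem_mem_dropBad _ _ _ _ hq ?_
  refine testBit_loopI hF hG (w := f A.length) (hv _ (by simp)).symm ?_ hA.1
    (fun i hi => hC i (by omega)) ?_ hA.2.2.1 (Nat.zero_testBit _)
  · intro a h
    exact hC.sel (i := A.length) (by simp) (by cases a <;> exact h)
  · intro k hk
    simp only [List.mem_cons, List.not_mem_nil, or_false, not_or]
    exact ⟨(hA.2.1 k hk).symm, (hv k (by simp; omega)).symm⟩

end Refute

/-! ### The rules provide new vertices -/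

section Rules

variable {V : Type*} {G : SimpleGraph V} {f : ℕ → V}

theorem Placed.injective : ∀ {A : List ℕ}, Placed G A f →
    ∀ i < A.length, ∀ j < A.length, f i = f j → i = j
  | [], _, i, hi, _, _, _ => absurd hi (by simp)
  | r :: A, hA, i, hi, j, hj, h => by
    rw [List.length_cons, Nat.lt_succ_iff_lt_or_eq] at hi hj
    rcases hi with hi | rfl <;> rcases hj with hj | rfl
    · exact hA.1.injective i hi j hj h
    · exact (hA.2.1 i hi h.symm).elim
    · exact (hA.2.1 j hj h).elim
    · rfl

theorem nbrs_cons (r : ℕ) (A : List ℕ) (a : ℕ) : nbrs (r :: A) a =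
    if A.length = a then r else
      if bit r a = true then Nat.lor (Nat.pow 2 A.length) (nbrs A a) else nbrs A a := by
  have e : nbrs (r :: A) a = Bool.rec (Bool.rec (nbrs A a) (Nat.lor (Nat.pow 2 A.length) (nbrs A a))
    (bit r a)) r (Nat.beq A.length a) := rfl
  rw [e]
  by_cases h : A.length = a
  · rw [if_pos h, show Nat.beq A.length a = true by simpa using h]
  · rw [if_neg h, show Nat.beq A.length a = false by
      rw [← Bool.not_eq_true]; exact fun h' => h (Nat.eq_of_beq_eq_true h')]
    cases bit r a <;> rfl

/-- Bounds on rows guarantee that a vertex is not recorded as adjacent to itself or to vertices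
placed later without reason. -/
theorem Placed.nbrs_lt (a : ℕ) : ∀ {A : List ℕ}, Placed G A f → nbrs A a < 2 ^ A.length
  | [], _ => by simp [nbrs]
  | r :: A, hA => by
    have h1 : 2 ^ A.length < 2 ^ (r :: A).length := Nat.pow_lt_pow_right (by omega) (by simp)
    have h2 := Placed.nbrs_lt a hA.1
    rw [nbrs_cons]
    split_ifs
    · exact hA.2.2.2.trans h1
    · exact Nat.or_lt_two_pow h1 (h2.trans h1)
    · exact h2.trans h1

theorem Placed.adj_iff : ∀ {A : List ℕ}, Placed G A f → ∀ a < A.length, ∀ j < A.length,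
    (G.Adj (f a) (f j) ↔ bit (nbrs A a) j = true)
  | [], _, i, hi, _, _ => absurd hi (by simp)
  | r :: A, hA, a, ha, j, hj => by
    rw [List.length_cons, Nat.lt_succ_iff_lt_or_eq] at ha hj
    rw [nbrs_cons]
    rcases ha with ha | rfl
    · rw [if_neg ha.ne']
      have hn := hA.1.nbrs_lt a
      rcases hj with hj | rfl
      · rw [hA.1.adj_iff a ha j hj]
        split_ifs
        · rw [bit_eq, bit_eq, testBit_lor, show (Nat.pow 2 A.length).testBit j = false from
            Nat.testBit_two_pow_of_ne hj.ne', Bool.false_or]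
        · rfl
      · rw [G.adj_comm, hA.2.2.1 a ha]
        split_ifs with h
        · simp only [h, true_iff]
          rw [bit_eq, testBit_lor, show (Nat.pow 2 A.length).testBit A.length = true from
            Nat.testBit_two_pow_self, Bool.true_or]
        · simp [h, bit_eq, Nat.testBit_lt_two_pow hn]
    · rw [if_pos rfl]
      rcases hj with hj | rfl
      · exact hA.2.2.1 j hj
      · simp [bit_eq, Nat.testBit_lt_two_pow hA.2.2.2]

theorem bit_maskOf (i : ℕ) : ∀ ps : List (ℕ × ℕ), bit (maskOf ps) i = true ↔ ∃ p ∈ ps, p.1 = i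
  | [] => by simp [maskOf, bit_eq]
  | p :: ps => by
    have ih := bit_maskOf i ps
    rw [bit_eq] at ih
    rw [bit_eq, maskOf, testBit_lor, Bool.or_eq_true, ih, show Nat.pow 2 p.1 = 2 ^ p.1 from rfl,
      Nat.testBit_two_pow]
    simp

theorem color_lt (c i : ℕ) : color c i < 4 :=
  (Nat.and_le_right (n := Nat.shiftRight c (Nat.mul 2 i)) (m := 3)).trans_lt (by omega)

/-- This is `IsCritical.exists_adj_not_adj` with the first components as `S` and the second
components as images. The vertex found there is new, since all placed vertices pass the inclusion
test on neighbourhoods. -/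
theorem Rule.exists_hit_core (hG : IsCritical G) {A : List ℕ} (hA : Placed G A f)
    {ps : List (ℕ × ℕ)} (h : (Rule.core ps).valid A = true) :
    ∃ v, (∀ i < A.length, v ≠ f i) ∧
      ∀ t, HasType G A.length f v t → (Rule.core ps).hit t = true := by
  simp only [Rule.valid, Bool.and_eq_true, List.all_eq_true, Bool.not_eq_true',
    List.isEmpty_eq_false_iff, Bool.or_eq_true, Nat.ble_eq] at h
  obtain ⟨hne, h⟩ := h
  have hlt : ∀ p ∈ ps, p.1 < A.length ∧ p.2 < A.length := fun p hp =>
    ⟨(h p hp).1.1.1.1, (h p hp).1.1.1.2⟩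
  let S : Set V := {x | ∃ p ∈ ps, f p.1 = x}
  -- A vertex may be the first component of several pairs. Any choice of image is good, because
  -- `valid` tests all pairs against each other.
  have hc : ∀ x : V, ∃ y, x ∈ S → ∃ p ∈ ps, f p.1 = x ∧ f p.2 = y := by
    intro x
    by_cases hx : x ∈ S
    · obtain ⟨p, hp, rfl⟩ := hx
      exact ⟨f p.2, fun _ => ⟨p, hp, rfl, rfl⟩⟩
    · exact ⟨x, fun h => (hx h).elim⟩
  choose φ hφ using hc
  obtain ⟨p₀, hp₀⟩ := List.exists_mem_of_ne_nil _ hne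
  obtain ⟨v, hvS, a, haS, h1, h2⟩ := hG.exists_adj_not_adj S ⟨_, p₀, hp₀, rfl⟩ φ (by
    rintro a haS ⟨q, hq, hqa⟩
    obtain ⟨p, hp, -, hpa⟩ := hφ a haS
    have e := hA.injective _ (hlt q hq).1 _ (hlt p hp).2 (hqa.trans hpa.symm)
    have := (h p hp).1.1.2
    rw [← Bool.not_eq_true, bit_maskOf] at this
    exact this ⟨q, hq, e⟩) (by
    intro a ha b hb hab
    obtain ⟨p, hp, hpa, hpa'⟩ := hφ a ha
    obtain ⟨q, hq, hqb, hqb'⟩ := hφ b hb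
    rw [← hpa, ← hqb, hA.adj_iff _ (hlt p hp).1 _ (hlt q hq).1] at hab
    rw [← hpa', ← hqb', hA.adj_iff _ (hlt p hp).2 _ (hlt q hq).2]
    rcases (h p hp).2 q hq with h' | h'
    · rw [h'] at hab
      exact absurd hab (by simp)
    · exact h')
  obtain ⟨p, hp, rfl, hpa⟩ := hφ a haS
  refine ⟨v, fun i hi hvi => ?_, fun t ht => ?_⟩
  · subst hvi
    rw [G.adj_comm, hA.adj_iff _ (hlt p hp).1 _ hi] at h1
    rw [← hpa, G.adj_comm, hA.adj_iff _ (hlt p hp).2 _ hi] at h2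
    -- If `v` were placed, it would be in `S` or adjacent to the image of `a`; both are excluded.
    have e := Nat.eq_of_beq_eq_true (h p hp).1.2
    rw [← e, bit_eq, testBit_land, testBit_lor, Bool.and_eq_true, Bool.or_eq_true, ← bit_eq,
      ← bit_eq, ← bit_eq, bit_maskOf] at h1
    rcases h1.2 with ⟨q, hq, rfl⟩ | h'
    · exact hvS ⟨q, hq, rfl⟩
    · exact h2 h'
  · simp only [Rule.hit, List.any_eq_true, Bool.and_eq_true, Bool.not_eq_true']
    refine ⟨p, hp, (ht _ (hlt p hp).1).1 h1, ?_⟩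
    rw [← Bool.not_eq_true, ← ht _ (hlt p hp).2, hpa]
    exact h2

/-- The placed neighbours of `u` form a set of at most three vertices, and `u` has a neighbour
outside this set; that neighbour cannot be placed. -/
theorem Rule.exists_hit_deg (hG : IsCritical G) {A : List ℕ} (hA : Placed G A f)
    {u : ℕ} (h : (Rule.deg u).valid A = true) :
    ∃ v, (∀ i < A.length, v ≠ f i) ∧
      ∀ t, HasType G A.length f v t → (Rule.deg u).hit t = true := by
  simp only [Rule.valid, Bool.and_eq_true, Nat.ble_eq] at h
  obtain ⟨hu, h⟩ := h
  classical
  let N : Finset V :=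
    (((List.range A.length).filter fun i => bit (nbrs A u) i).map f).toFinset
  have hN : N.card ≤ 3 := by
    refine (List.toFinset_card_le _).trans ?_
    rw [List.length_map, ← List.countP_eq_length_filter]
    exact h
  obtain ⟨v, hv, huv⟩ := hG.exists_adj_notMem (f u) N hN
  refine ⟨v, fun i hi hvi => hv ?_, fun t ht => (ht u hu).1 huv.symm⟩
  subst hvi
  simp only [N, List.mem_toFinset, List.mem_map, List.mem_filter, List.mem_range]
  exact ⟨i, ⟨hi, (hA.adj_iff u hu i hi).1 huv⟩, rfl⟩

/-- The coded colouring is proper on the placed vertices, so some outside vertex is adjacent to one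
of them, which means that its type is not `0`. -/
theorem Rule.exists_hit_conn (hG : IsCritical G) {A : List ℕ} (hA : Placed G A f)
    {c : ℕ} (h : (Rule.conn c).valid A = true) :
    ∃ v, (∀ i < A.length, v ≠ f i) ∧
      ∀ t, HasType G A.length f v t → (Rule.conn c).hit t = true := by
  simp only [Rule.valid, Bool.and_eq_true, List.all_eq_true, Bool.not_eq_true', List.mem_range,
    List.isEmpty_eq_false_iff, Bool.or_eq_true] at h
  obtain ⟨hne, h⟩ := h
  have hpos : 0 < A.length := List.length_pos_iff.2 hne
  let S : Set V := {x | ∃ i < A.length, f i = x}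
  have hc : ∀ x : V, ∃ i, x ∈ S → i < A.length ∧ f i = x := by
    intro x
    by_cases hx : x ∈ S
    · obtain ⟨i, hi, rfl⟩ := hx
      exact ⟨i, fun _ => ⟨hi, rfl⟩⟩
    · exact ⟨0, fun h => (hx h).elim⟩
  choose ι hι using hc
  obtain ⟨v, hvS, a, ⟨i, hi, rfl⟩, hva⟩ := hG.exists_adj_outside S ⟨f 0, 0, hpos, rfl⟩
    (fun x => ⟨color c (ι x), color_lt _ _⟩) (by
      intro x hx y hy hxy e
      obtain ⟨hx1, hx2⟩ := hι x hx
      obtain ⟨hy1, hy2⟩ := hι y hy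
      rw [← hx2, ← hy2, hA.adj_iff _ hx1 _ hy1] at hxy
      rcases h _ hx1 _ hy1 with h' | h'
      · rw [h'] at hxy
        exact absurd hxy (by simp)
      · rw [← Bool.not_eq_true] at h'
        exact h' (by simpa using e))
  refine ⟨v, fun i hi hvi => hvS ⟨i, hi, hvi.symm⟩, fun t ht => ?_⟩
  have hb := (ht i hi).1 hva
  simp only [Rule.hit, Bool.not_eq_true', ← Bool.not_eq_true]
  intro h0
  rw [Nat.eq_of_beq_eq_true h0] at hb
  simp [bit_eq] at hb

/-- A valid rule produces a new vertex. -/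
theorem Rule.exists_hit (hG : IsCritical G) {A : List ℕ} (hA : Placed G A f) :
    ∀ {ρ : Rule}, ρ.valid A = true → ∃ v, (∀ i < A.length, v ≠ f i) ∧
      ∀ t, HasType G A.length f v t → ρ.hit t = true
  | .core _, h => exists_hit_core hG hA h
  | .deg _, h => exists_hit_deg hG hA h
  | .conn _, h => exists_hit_conn hG hA h

end Rules

/-! ### Soundness of the search -/

section Check

variable {V : Type*} {G : SimpleGraph V} {f : ℕ → V}

/-- All vertices outside the placed graph have a type in the list `T`. -/
structure Typed (G : SimpleGraph V) (A T : List ℕ) (f : ℕ → V) : Prop where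
  placed : Placed G A f
  lt : ∀ t ∈ T, t < 2 ^ A.length
  exists_type : ∀ v, (∀ i < A.length, v ≠ f i) → ∃ t ∈ T, HasType G A.length f v t

theorem Placed.congr {f' : ℕ → V} : ∀ {A : List ℕ}, (∀ i < A.length, f i = f' i) →
    Placed G A f → Placed G A f'
  | [], _, _ => trivial
  | r :: A, h, hA => by
    have h0 := h A.length (by simp)
    have h' : ∀ i < A.length, f i = f' i := fun i hi => h i (by simp; omega)
    refine ⟨hA.1.congr h', fun j hj => ?_, fun j hj => ?_, hA.2.2.2⟩
    · rw [← h0, ← h' j hj]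
      exact hA.2.1 j hj
    · rw [← h0, ← h' j hj]
      exact hA.2.2.1 j hj

theorem exists_mem_double {n : ℕ} {T : List ℕ} (hT : ∀ t ∈ T, t < 2 ^ n) {v : V}
    (h : ∃ t ∈ T, HasType G n f v t) : ∃ t ∈ double n T, HasType G (n + 1) f v t := by
  obtain ⟨t, ht, htv⟩ := h
  by_cases hv : G.Adj v (f n)
  · refine ⟨Nat.add t (Nat.pow 2 n), List.mem_append_right _ (List.mem_map_of_mem ht), ?_⟩
    intro i hi
    have e : Nat.add t (Nat.pow 2 n) = 2 ^ n + t := Nat.add_comm _ _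
    rcases Nat.lt_succ_iff_lt_or_eq.1 hi with hi | rfl
    · rw [htv i hi, e, bit_eq, bit_eq, Nat.testBit_two_pow_add_gt hi]
    · rw [e, bit_eq, Nat.testBit_two_pow_add_eq, Nat.testBit_lt_two_pow (hT t ht)]
      simpa using hv
  · refine ⟨t, List.mem_append_left _ ht, ?_⟩
    intro i hi
    rcases Nat.lt_succ_iff_lt_or_eq.1 hi with hi | rfl
    · exact htv i hi
    · simpa [hv, bit_eq] using Nat.testBit_lt_two_pow (hT t ht)

theorem lt_of_mem_double {n : ℕ} {T : List ℕ} (hT : ∀ t ∈ T, t < 2 ^ n) :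
    ∀ t ∈ double n T, t < 2 ^ (n + 1) := by
  intro t ht
  rw [pow_succ]
  rcases List.mem_append.1 ht with h | h
  · have := hT t h
    omega
  · obtain ⟨s, hs, rfl⟩ := List.mem_map.1 h
    have := hT s hs
    have e : Nat.add s (Nat.pow 2 n) = s + 2 ^ n := rfl
    omega

/-- Adding a vertex of type `s`. -/
theorem Typed.cons {A T : List ℕ} (h : Typed G A T f) {s : ℕ} (hs : s < 2 ^ A.length) {v : V}
    (hv : ∀ i < A.length, v ≠ f i) (hsv : HasType G A.length f v s) :
    Typed G (s :: A) (double A.length T) (fun i => if i = A.length then v else f i) := by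
  have e : ∀ i < A.length, f i = (fun i => if i = A.length then v else f i) i := fun i hi => by
    simp [hi.ne]
  refine ⟨⟨h.placed.congr e, fun j hj => ?_, fun j hj => ?_, hs⟩, lt_of_mem_double h.lt, ?_⟩
  · rw [← e j hj]
    simpa using hv j hj
  · rw [← e j hj]
    simpa using hsv j hj
  · intro x hx
    refine exists_mem_double h.lt ?_
    obtain ⟨t, ht, htx⟩ := h.exists_type x fun i hi => by
      rw [e i hi]
      exact hx i (by simp; omega)
    exact ⟨t, ht, fun i hi => by rw [← e i hi]; exact htx i hi⟩

variable {F : List (ℕ → ℕ → Bool)} {Ls : List (List (List ℕ))}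

/-- The list of types only shrinks, and by `mem_refute` no type which is realized by a vertex gets
lost. -/
theorem Typed.refute (hF : ∀ h ∈ F, IsSimple h) (hG : ∀ h ∈ F, ¬ ∃ g, IsCopy G 5 h g)
    {A T : List ℕ} (h : Typed G A T f) : Typed G A (refute (killTree (codeTable F)) A T) f := by
  have hsub : ∀ t ∈ _root_.refute (killTree (codeTable F)) A T, t ∈ T := by
    have drop : ∀ (n : ℕ) (T : List ℕ) (bad : ℕ), ∀ t ∈ dropBad n T bad, t ∈ T := by
      intro n T
      induction T with
      | nil => exact fun _ _ h => h
      | cons s T ih =>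
        intro bad t ht
        have e : dropBad n (s :: T) bad = Nat.rec (s :: dropBad n T (Nat.shiftRight bad n))
          (fun _ _ => dropBad n T (Nat.shiftRight bad n)) (Nat.land bad 1) := rfl
        rw [e] at ht
        cases h : Nat.land bad 1 with
        | zero =>
          rw [h] at ht
          rcases List.mem_cons.1 ht with rfl | ht
          · simp
          · exact List.mem_cons_of_mem _ (ih _ t ht)
        | succ n =>
          rw [h] at ht
          exact List.mem_cons_of_mem _ (ih _ t ht)
    rcases A with _ | ⟨r, A⟩
    · exact fun t ht => ht
    · exact drop _ _ _
  refine ⟨h.placed, fun t ht => h.lt t (hsub t ht), fun v hv => ?_⟩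
  obtain ⟨t, ht, htv⟩ := h.exists_type v hv
  exact ⟨t, mem_refute hF hG h.placed h.lt ht hv htv, htv⟩

theorem length_digitsBelow (b : ℕ) : ∀ n c, (digitsBelow b n c).length = n
  | 0, _ => rfl
  | n + 1, c => by simp [digitsBelow, length_digitsBelow b n]

/-- A successful test exhibits an induced copy of a listed graph, contrary to assumption. -/
theorem leafOk_sound (hL : ∀ L ∈ Ls, ¬ ∃ g, IsCopy G L.length (listAdj L) g)
    {A : List ℕ} (hA : Placed G A f) {c : ℕ} : leafOk Ls A c ≠ true := by
  intro h
  simp only [leafOk, isCopyAt, Bool.and_eq_true, Nat.ble_eq, List.all_eq_true, decide_eq_true_iff,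
    List.mem_range, beq_iff_eq] at h
  obtain ⟨h1, ⟨h2, h3⟩, h4⟩ := h
  have hmem : Ls.getD (Nat.mod c 32) [] ∈ Ls := by
    rw [List.getD_eq_getElem _ _ h1]
    exact List.getElem_mem _
  generalize Ls.getD (Nat.mod c 32) [] = L at *
  have hlen := length_digitsBelow 32 L.length (Nat.div c 32)
  generalize digitsBelow 32 L.length (Nat.div c 32) = ps at *
  have hget : ∀ i < L.length, ps.getD i 0 < A.length := fun i hi => by
    rw [List.getD_eq_getElem _ _ (hlen ▸ hi)]
    exact h2 _ (List.getElem_mem _)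
  refine hL L hmem ⟨fun i => f (ps.getD i 0), fun i hi j hj e => ?_, fun i hi j hj => ?_⟩
  · have := hA.injective _ (hget i hi) _ (hget j hj) e
    rw [List.getD_eq_getElem _ _ (hlen ▸ hi), List.getD_eq_getElem _ _ (hlen ▸ hj)] at this
    exact (h3.getElem_inj_iff).1 this
  · rw [h4 i hi j hj]
    exact hA.adj_iff _ (hget i hi) _ (hget j hj)

/-- If some outside vertex has type `s`, the branch which places it cannot be accepted. Otherwise
`s` does not occur, may be struck from the candidates of all later branches, and the type of `v` is
among the remaining ones. This makes the sequential removal of types legitimate. -/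
theorem children_sound {k : List ℕ → List ℕ → List ℕ → Option (List ℕ)} {A : List ℕ}
    (hk : ∀ A T f h, Typed G A T f → k A T h = none) :
    ∀ {S T : List ℕ}, (∀ s ∈ S, s < 2 ^ A.length) → Typed G A T f →
      (∃ v, (∀ i < A.length, v ≠ f i) ∧ ∃ s ∈ S, HasType G A.length f v s) →
      ∀ {h}, children k A S T h = none
  | [], _, _, _, ⟨_, _, _, hs, _⟩, _ => absurd hs (by simp)
  | s :: S, T, hS, hT, ⟨v, hv, t, ht, htv⟩, h => by
    rw [children]
    by_cases hex : ∃ v, (∀ i < A.length, v ≠ f i) ∧ HasType G A.length f v s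
    · obtain ⟨v, hv, hsv⟩ := hex
      rw [hk _ _ _ h (hT.cons (hS s (by simp)) hv hsv)]
    · push Not at hex
      have ih := fun {h} => children_sound hk (S := S) (T := T.filter fun t => !Nat.beq t s)
        (fun s hs => hS s (by simp [hs]))
        ⟨hT.placed, fun t ht => hT.lt t (List.mem_filter.1 ht).1, fun x hx => by
          obtain ⟨t, ht, htx⟩ := hT.exists_type x hx
          refine ⟨t, List.mem_filter.2 ⟨ht, ?_⟩, htx⟩
          rw [Bool.not_eq_true', ← Bool.not_eq_true]
          intro e
          exact hex x hx (Nat.eq_of_beq_eq_true e ▸ htx)⟩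
        ⟨v, hv, t, by
          rcases List.mem_cons.1 ht with rfl | ht
          · exact (hex v hv htv).elim
          · exact ht, htv⟩ (h := h)
      cases k (s :: A) (double A.length T) h with
      | none => rfl
      | some h' => exact ih

/-- The checker never accepts for a critical graph without copies of the graphs in `F` and `Ls`. -/
theorem check_sound (hcrit : IsCritical G) (hF : ∀ h ∈ F, IsSimple h)
    (hG : ∀ h ∈ F, ¬ ∃ g, IsCopy G 5 h g)
    (hL : ∀ L ∈ Ls, ¬ ∃ g, IsCopy G L.length (listAdj L) g) :
    ∀ (k : ℕ) (A T : List ℕ) (f : ℕ → V) (h : List ℕ), Typed G A T f →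
      check (killTree (codeTable F)) Ls k A T h = none
  | 0, _, _, _, _, _ => by rw [check]
  | k + 1, A, T, f, [], _ => by rw [check]
  | k + 1, A, T, f, c :: h, hT => by
    rw [check]
    cases Nat.beq (Nat.mod c 4) 3 with
    | true =>
      rw [Bool.eq_false_iff.2 (leafOk_sound hL hT.placed)]
    | false =>
      cases hv : (decodeRule c).valid A with
      | false => rfl
      | true =>
        obtain ⟨v, hv, hit⟩ := Rule.exists_hit hcrit hT.placed hv
        cases bit c 2 with
        | true =>
          -- The type of the new vertex is hit by the rule and survives, so the list that should be
          -- empty is not.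
          obtain ⟨t, ht, htv⟩ := hT.exists_type v hv
          have := mem_refute hF hG hT.placed
            (fun t ht => hT.lt t (List.mem_filter.1 ht).1)
            (List.mem_filter.2 ⟨ht, hit t htv⟩) hv htv
          cases e : refute (killTree (codeTable F)) A (T.filter (decodeRule c).hit) with
          | nil =>
            rw [e] at this
            exact absurd this (by simp)
          | cons => rfl
        | false =>
          have hT' := hT.refute hF hG
          obtain ⟨t, ht, htv⟩ := hT'.exists_type v hv
          exact children_sound (check_sound hcrit hF hG hL k)
            (fun s hs => hT'.lt s (List.mem_filter.1 hs).1) hT'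
            ⟨v, hv, t, List.mem_filter.2 ⟨ht, hit t htv⟩, htv⟩

/-- With nothing placed, every vertex has type `0`; each placed vertex then doubles the list, which
is thinned out at once. -/
theorem Placed.typed_typesOf (hF : ∀ h ∈ F, IsSimple h) (hG : ∀ h ∈ F, ¬ ∃ g, IsCopy G 5 h g) :
    ∀ {A : List ℕ}, Placed G A f → Typed G A (typesOf (killTree (codeTable F)) A) f
  | [], _ => ⟨trivial, by simp [typesOf], fun v _ => ⟨0, by simp [typesOf], by simp [HasType]⟩⟩
  | r :: A, hA => by
    have ih := Placed.typed_typesOf hF hG hA.1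
    refine Typed.refute hF hG ⟨hA, lt_of_mem_double ih.lt, fun v hv => ?_⟩
    exact exists_mem_double ih.lt (ih.exists_type v fun i hi => hv i (by simp; omega))

end Check

/-! ### Searches for colourings and for induced copies -/

section Search

theorem boolRec_or (x y : Bool) : (Bool.rec y true x : Bool) = (x || y) := by cases x <;> rfl

theorem natBeq_iff {a b : ℕ} : Nat.beq a b = true ↔ a = b :=
  ⟨Nat.eq_of_beq_eq_true, fun h => h ▸ Nat.beq_refl _⟩

theorem boolRec_and (x y : Bool) : (Bool.rec false y x : Bool) = (x && y) := by cases x <;> rfl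

/-- The set of the `j < n` with `h j = true`, as a bit mask. -/
def maskBelow (h : ℕ → Bool) : ℕ → ℕ
  | 0 => 0
  | n + 1 => match h n with
    | true => Nat.add (Nat.pow 2 n) (maskBelow h n)
    | false => maskBelow h n

theorem maskBelow_lt (h : ℕ → Bool) : ∀ n, maskBelow h n < 2 ^ n
  | 0 => by simp [maskBelow]
  | n + 1 => by
    have ih := maskBelow_lt h n
    rw [maskBelow, pow_succ]
    cases h n with
    | true =>
      have : Nat.add (Nat.pow 2 n) (maskBelow h n) = 2 ^ n + maskBelow h n := rfl
      simp only [this]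
      omega
    | false => simp only; omega

theorem testBit_maskBelow (h : ℕ → Bool) (j : ℕ) : ∀ n,
    (maskBelow h n).testBit j = (decide (j < n) && h j)
  | 0 => by simp [maskBelow]
  | n + 1 => by
    have ih := testBit_maskBelow h j n
    rw [maskBelow]
    rcases lt_trichotomy j n with hj | rfl | hj
    · cases hn : h n with
      | true =>
        have : Nat.add (Nat.pow 2 n) (maskBelow h n) = 2 ^ n + maskBelow h n := rfl
        simp only [this, Nat.testBit_two_pow_add_gt hj, ih]
        simp [hj, hj.trans (Nat.lt_succ_self n)]
      | false =>
        simp only [ih]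
        simp [hj, hj.trans (Nat.lt_succ_self n)]
    · cases hn : h j with
      | true =>
        have : Nat.add (Nat.pow 2 j) (maskBelow h j) = 2 ^ j + maskBelow h j := rfl
        simp only [this, Nat.testBit_two_pow_add_eq, ih]
        simp
      | false => simp [ih]
    · have h1 := maskBelow_lt h (n + 1)
      rw [maskBelow] at h1
      rw [Nat.testBit_lt_two_pow (h1.trans_le (Nat.pow_le_pow_right (by omega) hj))]
      simp; omega

/-- The neighbourhood of `i` in the Boolean graph `h` on `{0, …, n - 1}`. -/
def nbrMask (h : ℕ → ℕ → Bool) (n i : ℕ) : ℕ := maskBelow (h i) n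

/-- Search for four colour classes which extend the classes `a`, `b`, `c`, `d` to the vertices
in the list `l` of pairs (vertex, neighbourhood) and satisfy `P`. -/
noncomputable def colorSearch (P : ℕ → ℕ → ℕ → ℕ → Bool) (l : List (ℕ × ℕ)) :
    ℕ → ℕ → ℕ → ℕ → Bool :=
  List.rec P (fun v _ ih a b c d =>
    Bool.rec (Bool.rec (Bool.rec (Bool.rec false (ih a b c (Nat.lor d v.1))
      (Nat.beq (Nat.land v.2 d) 0)) true (Bool.rec false (ih a b (Nat.lor c v.1) d)
      (Nat.beq (Nat.land v.2 c) 0))) true (Bool.rec false (ih a (Nat.lor b v.1) c d)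
      (Nat.beq (Nat.land v.2 b) 0))) true (Bool.rec false (ih (Nat.lor a v.1) b c d)
      (Nat.beq (Nat.land v.2 a) 0))) l

theorem colorSearch_cons (P : ℕ → ℕ → ℕ → ℕ → Bool) (v : ℕ × ℕ) (l : List (ℕ × ℕ)) (a b c d : ℕ) :
    colorSearch P (v :: l) a b c d =
      ((Nat.beq (Nat.land v.2 a) 0 && colorSearch P l (Nat.lor a v.1) b c d) ||
      ((Nat.beq (Nat.land v.2 b) 0 && colorSearch P l a (Nat.lor b v.1) c d) ||
      ((Nat.beq (Nat.land v.2 c) 0 && colorSearch P l a b (Nat.lor c v.1) d) ||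
      (Nat.beq (Nat.land v.2 d) 0 && colorSearch P l a b c (Nat.lor d v.1))))) := by
  rw [← boolRec_or, ← boolRec_or, ← boolRec_or, ← boolRec_and, ← boolRec_and, ← boolRec_and,
    ← boolRec_and]
  rfl

/-- A positive answer needs no invariant of the search: the test `P` on the final classes contains
all that is used. -/
theorem exists_of_colorSearch {P : ℕ → ℕ → ℕ → ℕ → Bool} : ∀ {l : List (ℕ × ℕ)} {a b c d : ℕ},
    colorSearch P l a b c d = true → ∃ a b c d, P a b c d = true
  | [], a, b, c, d, h => ⟨a, b, c, d, h⟩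
  | v :: l, a, b, c, d, h => by
    rw [colorSearch_cons] at h
    simp only [Bool.or_eq_true, Bool.and_eq_true] at h
    rcases h with h | h | h | h <;> exact exists_of_colorSearch h.2

/-- The search can follow `χ`, putting each vertex into the class of its colour, as long as the
classes hold only vertices of their colour. So a failed search proves that there is no colouring. -/
theorem colorSearch_of_coloring {h : ℕ → ℕ → Bool} {n : ℕ} {χ : ℕ → Fin 4}
    (hχ : ∀ i < n, ∀ j < n, h i j = true → χ i ≠ χ j) : ∀ {l : List ℕ}, (∀ i ∈ l, i < n) →
    ∀ {a b c d : ℕ}, (∀ j, a.testBit j = true → j < n ∧ χ j = 0) →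
      (∀ j, b.testBit j = true → j < n ∧ χ j = 1) → (∀ j, c.testBit j = true → j < n ∧ χ j = 2) →
      (∀ j, d.testBit j = true → j < n ∧ χ j = 3) →
      colorSearch (fun _ _ _ _ => true) (l.map fun i => (Nat.pow 2 i, nbrMask h n i)) a b c d = true
  | [], _, _, _, _, _, _, _, _, _ => rfl
  | i :: l, hl, a, b, c, d, ha, hb, hc, hd => by
    have hi := hl i (by simp)
    have key : ∀ (m : ℕ) (k : Fin 4), (∀ j, m.testBit j = true → j < n ∧ χ j = k) → χ i = k →
        Nat.beq (Nat.land (nbrMask h n i) m) 0 = true ∧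
          ∀ j, (Nat.lor m (Nat.pow 2 i)).testBit j = true → j < n ∧ χ j = k := by
      intro m k hm hk
      constructor
      · rw [natBeq_iff]
        refine Nat.eq_of_testBit_eq fun j => ?_
        rw [testBit_land, Nat.zero_testBit, ← Bool.not_eq_true, Bool.and_eq_true, nbrMask,
          testBit_maskBelow, Bool.and_eq_true, decide_eq_true_iff]
        rintro ⟨⟨h1, h2⟩, h3⟩
        exact hχ i hi j h1 h2 (hk.trans (hm j h3).2.symm)
      · intro j hj
        rw [testBit_lor, Bool.or_eq_true, show Nat.pow 2 i = 2 ^ i from rfl, Nat.testBit_two_pow,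
          decide_eq_true_iff] at hj
        rcases hj with hj | rfl
        · exact hm j hj
        · exact ⟨hi, hk⟩
    have ih := fun {a b c d} =>
      colorSearch_of_coloring hχ (l := l) (a := a) (b := b) (c := c) (d := d) (fun i hi => hl i (by simp [hi]))
    rw [List.map_cons, colorSearch_cons]
    simp only [Bool.or_eq_true, Bool.and_eq_true]
    obtain hk | hk | hk | hk : χ i = 0 ∨ χ i = 1 ∨ χ i = 2 ∨ χ i = 3 := by
      generalize χ i = k
      revert k
      decide
    · exact Or.inl ⟨(key a 0 ha hk).1, ih (key a 0 ha hk).2 hb hc hd⟩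
    · exact Or.inr (Or.inl ⟨(key b 1 hb hk).1, ih ha (key b 1 hb hk).2 hc hd⟩)
    · exact Or.inr (Or.inr (Or.inl ⟨(key c 2 hc hk).1, ih ha hb (key c 2 hc hk).2 hd⟩))
    · exact Or.inr (Or.inr (Or.inr ⟨(key d 3 hd hk).1, ih ha hb hc (key d 3 hd hk).2⟩))

/-- The class `m` contains `i` and no neighbour of `i`. -/
def inClass (h : ℕ → ℕ → Bool) (n i m : ℕ) : Bool :=
  bit m i && Nat.beq (Nat.land (nbrMask h n i) m) 0

/-- The Boolean graph `h` is `4`-colourable. -/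
noncomputable def isColorable (h : ℕ → ℕ → Bool) (n : ℕ) : Bool :=
  colorSearch (fun _ _ _ _ => true)
    ((List.range n).map fun i => (Nat.pow 2 i, nbrMask h n i)) 0 0 0 0

/-- The Boolean graph `h` has a `4`-colouring away from the vertex `v`. -/
noncomputable def isColorableWithout (h : ℕ → ℕ → Bool) (n v : ℕ) : Bool :=
  colorSearch (fun a b c d => (List.range n).all fun i => Nat.beq i v || inClass h n i a ||
      inClass h n i b || inClass h n i c || inClass h n i d)
    (((List.range n).filter fun i => !Nat.beq i v).map fun i => (Nat.pow 2 i, nbrMask h n i))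
    0 0 0 0

theorem isColorable_of_coloring {h : ℕ → ℕ → Bool} {n : ℕ} {χ : ℕ → Fin 4}
    (hχ : ∀ i < n, ∀ j < n, h i j = true → χ i ≠ χ j) : isColorable h n = true :=
  colorSearch_of_coloring hχ (fun i hi => List.mem_range.1 hi) (by simp) (by simp) (by simp)
    (by simp)

theorem exists_coloring_of_isColorableWithout {h : ℕ → ℕ → Bool} {n v : ℕ}
    (H : isColorableWithout h n v = true) : ∃ χ : ℕ → Fin 4,
      ∀ i < n, ∀ j < n, i ≠ v → j ≠ v → h i j = true → χ i ≠ χ j := by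
  obtain ⟨a, b, c, d, H⟩ := exists_of_colorSearch H
  simp only [List.all_eq_true, List.mem_range, Bool.or_eq_true, natBeq_iff] at H
  -- The colour of `i` is the index of a class which contains `i` and none of its neighbours.
  have key : ∀ i, ∃ k : Fin 4, i < n → i ≠ v → inClass h n i (![a, b, c, d] k) = true := by
    intro i
    by_cases hi : i < n ∧ i ≠ v
    · rcases H i hi.1 with (((h' | h') | h') | h') | h'
      · exact (hi.2 h').elim
      · exact ⟨0, fun _ _ => h'⟩
      · exact ⟨1, fun _ _ => h'⟩
      · exact ⟨2, fun _ _ => h'⟩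
      · exact ⟨3, fun _ _ => h'⟩
    · exact ⟨0, fun h1 h2 => (hi ⟨h1, h2⟩).elim⟩
  choose χ hχ using key
  refine ⟨χ, fun i hi j hj hiv hjv hij e => ?_⟩
  have h1 := hχ i hi hiv
  have h2 := hχ j hj hjv
  rw [← e] at h2
  simp only [inClass, Bool.and_eq_true, natBeq_iff, bit_eq] at h1 h2
  have := congrArg (fun m => m.testBit j) h1.2
  rw [testBit_land, h2.1, nbrMask, testBit_maskBelow] at this
  simp [hj, hij] at this

/-- The vertices in `full` whose adjacency to the vertices chosen so far is given by `r`. -/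
noncomputable def candidates (full r : ℕ) (ch : List (ℕ × ℕ × ℕ)) : ℕ :=
  List.rec full (fun e _ ih => Nat.land (Nat.rec e.2.2 (fun _ _ => e.2.1) (Nat.land r e.1)) ih) ch

/-- Search for an induced copy of the graph with neighbourhoods `H` on the vertices in `W`, which
are given with their neighbourhoods and non-neighbourhoods. -/
noncomputable def copySearch (full : ℕ) (W : List (ℕ × ℕ × ℕ)) (H : List ℕ) :
    ℕ → List (ℕ × ℕ × ℕ) → Bool :=
  List.rec (fun _ _ => true) (fun r _ ih b ch =>
    List.rec false (fun w _ ih' => Bool.rec (Bool.rec ih' true (ih (Nat.mul 2 b) ((b, w.2) :: ch)))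
      ih' (Nat.beq (Nat.land (candidates full r ch) w.1) 0)) W) H

/-- A vertex of `g` with its neighbourhood and non-neighbourhood. -/
def host (g : ℕ → ℕ → Bool) (n a : ℕ) : ℕ × ℕ × ℕ :=
  (Nat.pow 2 a, nbrMask g n a, nbrMask (fun a b => !Nat.beq a b && !g a b) n a)

/-- The Boolean graph `h` on `k` vertices has an induced copy in `g` on `n` vertices. -/
noncomputable def hasCopy (h : ℕ → ℕ → Bool) (k : ℕ) (g : ℕ → ℕ → Bool) (n : ℕ) : Bool :=
  copySearch (Nat.pow 2 n - 1) ((List.range n).map (host g n))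
    ((List.range k).map (nbrMask h k)) 1 []

theorem copySearch_cons_of_mem {full : ℕ} {W : List (ℕ × ℕ × ℕ)} {r : ℕ} {H : List ℕ} {b : ℕ}
    {ch : List (ℕ × ℕ × ℕ)} {w : ℕ × ℕ × ℕ} (hw : w ∈ W)
    (h1 : Nat.land (candidates full r ch) w.1 ≠ 0)
    (h2 : copySearch full W H (2 * b) ((b, w.2) :: ch) = true) :
    copySearch full W (r :: H) b ch = true := by
  have e : ∀ W', copySearch full W' (r :: H) b ch = List.rec false (fun w _ ih' =>
      Bool.rec (Bool.rec ih' true (copySearch full W' H (2 * b) ((b, w.2) :: ch)))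
      ih' (Nat.beq (Nat.land (candidates full r ch) w.1) 0)) W' := fun _ => rfl
  rw [e]
  generalize copySearch full W H (2 * b) = K at *
  induction W with
  | nil => exact absurd hw (by simp)
  | cons u W ih =>
    simp only
    rcases List.mem_cons.1 hw with rfl | hw
    · rw [Bool.eq_false_iff.2 fun h => h1 (Nat.eq_of_beq_eq_true h), h2]
    · rw [ih hw]
      cases Nat.beq (Nat.land (candidates full r ch) u.1) 0 <;> cases K ((b, u.2) :: ch) <;> rfl

/-- The search can follow a given copy `p`: if the images of the vertices before `i` have been
chosen as by `p`, then `p i` is still a candidate. Only this direction is needed, since failed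
searches are used to exclude copies. -/
theorem copySearch_of_copy {h g : ℕ → ℕ → Bool} (hs : IsSimple h) {k n : ℕ} {p : ℕ → ℕ}
    (hp : ∀ i < k, p i < n) (hinj : ∀ i < k, ∀ j < k, p i = p j → i = j)
    (hadj : ∀ i < k, ∀ j < k, g (p i) (p j) = h i j) : ∀ (l i : ℕ), i + l = k →
    ∀ {ch : List (ℕ × ℕ × ℕ)},
      (∀ e ∈ ch, ∃ j < i, e = (2 ^ j, (host g n (p j)).2)) →
      copySearch (Nat.pow 2 n - 1) ((List.range n).map (host g n))
        ((List.range' i l).map (nbrMask h k)) (2 ^ i) ch = true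
  | 0, _, _, _, _ => rfl
  | l + 1, i, hil, ch, hch => by
    have hi : i < k := by omega
    rw [List.range'_succ, List.map_cons]
    refine copySearch_cons_of_mem (w := host g n (p i))
      (List.mem_map_of_mem (List.mem_range.2 (hp i hi))) ?_ ?_
    · have hc : ∀ (full : ℕ), full.testBit (p i) = true → ∀ (ch : List (ℕ × ℕ × ℕ)),
          (∀ e ∈ ch, ∃ j < i, e = (2 ^ j, (host g n (p j)).2)) →
          (candidates full (nbrMask h k i) ch).testBit (p i) = true := by
        intro full hfull ch
        induction ch with
        | nil => exact fun _ => hfull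
        | cons e ch ih =>
          intro hch
          obtain ⟨j, hj, he⟩ := hch e (by simp)
          have ih := ih fun e he => hch e (by simp [he])
          have hjk : j < k := by omega
          rw [show candidates full (nbrMask h k i) (e :: ch) = Nat.land (Nat.rec e.2.2
            (fun _ _ => e.2.1) (Nat.land (nbrMask h k i) e.1)) (candidates full (nbrMask h k i) ch)
            from rfl, testBit_land, ih, Bool.and_true, he]
          have hb := land_two_pow_beq (nbrMask h k i) j
          rw [bit_eq, nbrMask, testBit_maskBelow] at hb
          simp only [hjk, decide_true, Bool.true_and] at hb
          change Nat.testBit (Nat.rec _ _ (Nat.land (nbrMask h k i) (Nat.pow 2 j))) _ = true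
          have hgp : g (p j) (p i) = h i j := by rw [hadj j hjk i hi, hs.symm]
          cases hz : Nat.land (nbrMask h k i) (Nat.pow 2 j) with
          | zero =>
            rw [nbrMask] at hz
            rw [hz] at hb
            have hb' : h i j = false := by simpa using hb.symm
            change Nat.testBit (nbrMask (fun a b => !Nat.beq a b && !g a b) n (p j)) (p i) = true
            simp only [nbrMask, testBit_maskBelow, hp i hi, decide_true, Bool.true_and, hgp, hb',
              Bool.not_false, Bool.and_true, Bool.not_eq_true', ← Bool.not_eq_true]
            -- The stored non-neighbourhood of a vertex omits the vertex itself, so injectivity of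
            -- `p` enters here.
            exact fun e => hj.ne (hinj j hjk i hi (Nat.eq_of_beq_eq_true e))
          | succ m =>
            rw [nbrMask] at hz
            rw [hz] at hb
            have hb' : h i j = true := by
              rw [← hb]
              rfl
            simp only [host, nbrMask, testBit_maskBelow, hp i hi, decide_true, Bool.true_and, hgp,
              hb']
      have hbit := hc (Nat.pow 2 n - 1) (by
        rw [show Nat.pow 2 n = 2 ^ n from rfl, Nat.testBit_two_pow_sub_one]
        simpa using hp i hi) ch hch
      have := land_two_pow_beq (candidates (Nat.pow 2 n - 1) (nbrMask h k i) ch) (p i)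
      rw [bit_eq, hbit, Bool.not_eq_true', ← Bool.not_eq_true] at this
      intro h0
      rw [show (host g n (p i)).1 = Nat.pow 2 (p i) from rfl] at h0
      exact this (by rw [h0]; rfl)
    · rw [show 2 * 2 ^ i = 2 ^ (i + 1) by rw [pow_succ, Nat.mul_comm]]
      refine copySearch_of_copy hs hp hinj hadj l (i + 1) (by omega) ?_
      intro e he
      rcases List.mem_cons.1 he with rfl | he
      · exact ⟨i, by omega, rfl⟩
      · obtain ⟨j, hj, rfl⟩ := hch e he
        exact ⟨j, by omega, rfl⟩

theorem hasCopy_of_copy {h g : ℕ → ℕ → Bool} (hs : IsSimple h) {k n : ℕ} {p : ℕ → ℕ}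
    (hp : ∀ i < k, p i < n) (hinj : ∀ i < k, ∀ j < k, p i = p j → i = j)
    (hadj : ∀ i < k, ∀ j < k, g (p i) (p j) = h i j) : hasCopy h k g n = true := by
  rw [hasCopy, List.range_eq_range' (n := k)]
  exact copySearch_of_copy hs hp hinj hadj k 0 (by omega) (by simp)

end Search

/-! ### Induced `5`-cycles and the two runs of the search -/

section Cycle

variable {V : Type*} {G : SimpleGraph V} {f : ℕ → V}

/-- The backward neighbourhoods in the cycle `0 - 1 - 2 - 3 - 4 - 0`, last vertex first. -/
def cycRows : List ℕ := [9, 4, 2, 1, 0]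

theorem placed_cycRows (hf : IsCopy G 5 cycAdj f) : Placed G cycRows f := by
  have hne : ∀ i < 5, ∀ j < 5, i ≠ j → f i ≠ f j := fun i hi j hj h e => h (hf.1 i hi j hj e)
  have key : ∀ (A : List ℕ) (r : ℕ), A.length < 5 → Placed G A f → r < 2 ^ A.length →
      (∀ j < A.length, cycAdj A.length j = bit r j) → Placed G (r :: A) f := by
    intro A r hA h hr hj
    refine ⟨h, fun j hj => hne _ hA _ (by omega) (by omega), fun j hj' => ?_, hr⟩
    rw [hf.2 _ hA _ (by omega), hj j hj']
  refine key _ _ (by decide) (key _ _ (by decide) (key _ _ (by decide) (key _ _ (by decide)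
    (key _ _ (by decide) trivial ?_ ?_) ?_ ?_) ?_ ?_) ?_ ?_) ?_ ?_ <;> decide

/-- A symmetry of the cycle on `{0, …, 4}`, for `a = 1` and `a = 4`. -/
def turn (a b i : ℕ) : ℕ := Nat.mod (Nat.add (Nat.mul a i) b) 5

/-- Since `4` is `-1` modulo `5`, these maps are the rotations and reflections of the cycle. -/
theorem IsCopy.turn (hf : IsCopy G 5 cycAdj f) {a b : ℕ} (ha : a ∈ [1, 4])
    (hb : b ∈ List.range 5) : IsCopy G 5 cycAdj fun i => f (turn a b i) := by
  have h1 : ∀ i < 5, _root_.turn a b i < 5 := fun i _ => Nat.mod_lt _ (by omega)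
  have h2 : ∀ a ∈ [1, 4], ∀ b ∈ List.range 5, ∀ i < 5, ∀ j < 5,
      (_root_.turn a b i = _root_.turn a b j → i = j) ∧
        cycAdj (_root_.turn a b i) (_root_.turn a b j) = cycAdj i j := by decide
  refine ⟨fun i hi j hj e => (h2 a ha b hb i hi j hj).1 (hf.1 _ (h1 i hi) _ (h1 j hj) e),
    fun i hi j hj => ?_⟩
  rw [hf.2 _ (h1 i hi) _ (h1 j hj), (h2 a ha b hb i hi j hj).2]

/-- No vertex outside an induced `5`-cycle of `G` has the type `x` on it. -/
def NoType (G : SimpleGraph V) (x : ℕ) : Prop :=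
  ∀ f, IsCopy G 5 cycAdj f → ∀ v, (∀ i < 5, v ≠ f i) → ¬ HasType G 5 f v x

/-- The types on the `5`-cycle which are equivalent to `x` under the symmetries of the cycle. -/
def orbit (x : ℕ) : List ℕ := (List.range 32).filter fun t => [1, 4].any fun a =>
  (List.range 5).any fun b => (List.range 5).all fun i => bit x i == bit t (turn a b i)

/-- Renumbering the cycle by a symmetry turns type `t` into type `x`, and `NoType` speaks of all
numberings. -/
theorem NoType.of_mem_orbit {x t : ℕ} (hx : NoType G x) (ht : t ∈ orbit x) : NoType G t := by
  simp only [orbit, List.mem_filter, List.any_eq_true, List.all_eq_true, beq_iff_eq] at ht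
  obtain ⟨-, a, ha, b, hb, h⟩ := ht
  have h1 : ∀ i < 5, turn a b i < 5 := fun i _ => Nat.mod_lt _ (by omega)
  intro f hf v hv hvt
  refine hx _ (hf.turn ha hb) v (fun i hi => hv _ (h1 i hi)) fun i hi => ?_
  rw [hvt _ (h1 i hi), h i (List.mem_range.2 hi)]

/-- Exclude types on a `5`-cycle one after the other, by certificates, until only the type of a
vertex without neighbours on the cycle is left. -/
noncomputable def stages (t : DTree) (Ls : List (List (List ℕ))) (T : List ℕ) :
    List (ℕ × List ℕ) → List ℕ → Bool
  | [], ex => T.all fun t => List.contains ex t || Nat.beq t 0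
  | p :: l, ex => Nat.ble (Nat.succ p.1) 32 && (check t Ls 30 (p.1 :: cycRows)
      (double 5 (T.filter fun t => !List.contains ex t)) p.2).isSome &&
      stages t Ls T l (orbit p.1 ++ ex)

variable {F : List (ℕ → ℕ → Bool)} {Ls : List (List (List ℕ))}

/-- A type that has been excluded is excluded on every induced `5`-cycle and together with its
orbit, so later certificates start with fewer candidates. In the end all outside vertices have no
neighbour on the cycle, which is incompatible with the minimum degree. -/
theorem not_exists_cycle (hcrit : IsCritical G) (hF : ∀ h ∈ F, IsSimple h)
    (hG : ∀ h ∈ F, ¬ ∃ g, IsCopy G 5 h g)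
    (hL : ∀ L ∈ Ls, ¬ ∃ g, IsCopy G L.length (listAdj L) g) :
    ∀ {l : List (ℕ × List ℕ)} {ex : List ℕ}, (∀ x ∈ ex, NoType G x) →
      stages (killTree (codeTable F)) Ls (typesOf (killTree (codeTable F)) cycRows) l ex = true →
      ¬ ∃ f, IsCopy G 5 cycAdj f
  | [], ex, hex, hs, ⟨f, hf⟩ => by
    simp only [stages, List.all_eq_true, Bool.or_eq_true, List.contains_iff_mem, natBeq_iff] at hs
    have hp := placed_cycRows hf
    -- A vertex of the cycle has two neighbours on it, so the degree rule gives an outside neighbour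
    -- of `f 0`.
    obtain ⟨v, hv, hit⟩ := Rule.exists_hit hcrit hp (ρ := .deg 0) (by decide)
    obtain ⟨t, ht, hvt⟩ := (hp.typed_typesOf hF hG).exists_type v hv
    rcases hs t ht with h | rfl
    · exact hex t h f hf v hv hvt
    · exact absurd (hit 0 hvt) (by decide)
  | (x, h) :: l, ex, hex, hs, hf => by
    rw [stages, Bool.and_eq_true, Bool.and_eq_true, Nat.ble_eq] at hs
    obtain ⟨⟨hx, hc⟩, hs⟩ := hs
    have hno : NoType G x := by
      intro f hf v hv hvt
      have hp := placed_cycRows hf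
      have hT := hp.typed_typesOf hF hG
      have hT' : Typed G cycRows ((typesOf (killTree (codeTable F)) cycRows).filter
          fun t => !List.contains ex t) f := by
        refine ⟨hp, fun t ht => hT.lt t (List.mem_filter.1 ht).1, fun w hw => ?_⟩
        obtain ⟨t, ht, hwt⟩ := hT.exists_type w hw
        refine ⟨t, List.mem_filter.2 ⟨ht, ?_⟩, hwt⟩
        rw [Bool.not_eq_true', ← Bool.not_eq_true, List.contains_iff_mem]
        exact fun h => hex t h f hf w hw hwt
      have := check_sound hcrit hF hG hL 30 _ _ _ h (hT'.cons hx hv hvt)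
      rw [show double 5 = double cycRows.length from rfl, this] at hc
      simp at hc
    refine not_exists_cycle hcrit hF hG hL (fun y hy => ?_) hs hf
    rcases List.mem_append.1 hy with hy | hy
    · exact hno.of_mem_orbit hy
    · exact hex y hy

/-- The empty graph is `4`-colourable, so there is a vertex from which to start. -/
theorem not_isSome_check (hcrit : IsCritical G) (hF : ∀ h ∈ F, IsSimple h)
    (hG : ∀ h ∈ F, ¬ ∃ g, IsCopy G 5 h g)
    (hL : ∀ L ∈ Ls, ¬ ∃ g, IsCopy G L.length (listAdj L) g) (k : ℕ) (h : List ℕ) :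
    (check (killTree (codeTable F)) Ls k [0] (typesOf (killTree (codeTable F)) [0]) h).isSome ≠
      true := by
  intro hs
  obtain ⟨v⟩ : Nonempty V := by
    by_contra hV
    rw [not_nonempty_iff] at hV
    exact hcrit.false_of_coloring isEmptyElim fun x => isEmptyElim x
  have hp : Placed G [0] fun _ => v := ⟨trivial, by simp, by simp, by simp⟩
  rw [check_sound hcrit hF hG hL k _ _ _ h (hp.typed_typesOf hF hG)] at hs
  simp at hs

theorem isSimple_pathAdj : IsSimple pathAdj :=
  ⟨fun i j => Bool.or_comm _ _, fun i => by
    rw [← Bool.not_eq_true, pathAdj, Bool.or_eq_true, natBeq_iff]; omega⟩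

theorem isSimple_complAdj : IsSimple complAdj :=
  ⟨fun i j => by
    rw [Bool.eq_iff_iff]
    simp only [complAdj, Bool.not_eq_true', ← Bool.not_eq_true, natBeq_iff]
    omega, fun i => by
    simp [complAdj]⟩

theorem isSimple_cycAdj : IsSimple cycAdj :=
  ⟨fun i j => by
    rw [Bool.eq_iff_iff]
    simp only [cycAdj, pathAdj, Bool.or_eq_true, natBeq_iff]
    omega, fun i => by
    rw [← Bool.not_eq_true]
    simp only [cycAdj, pathAdj, Bool.or_eq_true, natBeq_iff]
    omega⟩

theorem isSimple_gemAdj : IsSimple gemAdj :=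
  ⟨fun i j => by
    rw [Bool.eq_iff_iff]
    simp only [gemAdj, Bool.and_eq_true, Bool.or_eq_true, Bool.not_eq_true', ← Bool.not_eq_true,
      natBeq_iff]
    omega, fun i => by
    simp [gemAdj]⟩

theorem isSimple_coAdj : IsSimple coAdj :=
  ⟨fun i j => by
    rw [Bool.eq_iff_iff]
    simp only [coAdj, pathAdj, Bool.and_eq_true, Bool.or_eq_true, Bool.not_eq_true',
      ← Bool.not_eq_true, natBeq_iff, Nat.ble_eq]
    omega, fun i => by
    simp [coAdj]⟩

/-- The adjacency lists of the complete graph on five vertices. -/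
def completeList : List (List ℕ) :=
  [[1, 2, 3, 4], [0, 2, 3, 4], [0, 1, 3, 4], [0, 1, 2, 4], [0, 1, 2, 3]]

/-- A critical graph without induced copies of the path and of `h` contains a graph in `Ls`, if
there are certificates for this. -/
theorem exists_copy_of_certificates (hcrit : IsCritical G) {h : ℕ → ℕ → Bool} (hh : IsSimple h)
    (hpath : ¬ ∃ g, IsCopy G 5 pathAdj g) (hG : ¬ ∃ g, IsCopy G 5 h g)
    (hmem : completeList ∈ Ls) {l : List (ℕ × List ℕ)} {k : List ℕ}
    (hl : stages (killTree (codeTable [pathAdj, h, complAdj])) Ls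
      (typesOf (killTree (codeTable [pathAdj, h, complAdj])) cycRows) l [] = true)
    (hk : (check (killTree (codeTable [pathAdj, h, complAdj, cycAdj])) Ls 30 [0]
      (typesOf (killTree (codeTable [pathAdj, h, complAdj, cycAdj])) [0]) k).isSome = true) :
    ∃ L ∈ Ls, ∃ g, IsCopy G L.length (listAdj L) g := by
  by_contra! H
  have hL : ∀ L ∈ Ls, ¬ ∃ g, IsCopy G L.length (listAdj L) g := fun L hL ⟨g, hg⟩ => H L hL g hg
  have hcompl : ¬ ∃ g, IsCopy G 5 complAdj g := by
    -- A complete subgraph on five vertices is a copy of a listed graph; this is why it may be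
    -- forbidden in the searches.
    rintro ⟨g, hg⟩
    have e : ∀ i < 5, ∀ j < 5, complAdj i j = listAdj completeList i j := by decide
    exact H _ hmem g ⟨hg.1, fun i hi j hj => by rw [hg.2 i hi j hj, e i hi j hj]⟩
  have hcyc : ¬ ∃ g, IsCopy G 5 cycAdj g := not_exists_cycle hcrit
    (by simp [hh, isSimple_pathAdj, isSimple_complAdj])
    (by simp only [List.forall_mem_cons]; exact ⟨hpath, hG, hcompl, by simp⟩) hL (by simp) hl
  exact not_isSome_check hcrit (by simp [hh, isSimple_pathAdj, isSimple_complAdj, isSimple_cycAdj])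
    (by simp only [List.forall_mem_cons]; exact ⟨hpath, hG, hcompl, hcyc, by simp⟩) hL 30 k hk

end Cycle

/-! ### From Boolean graphs to graphs and isomorphism classes -/

section Transfer

variable {V W : Type*} {G : SimpleGraph V}

theorem isIndContained_iff_exists_copy {H : SimpleGraph W} {n : ℕ} (hn : 0 < n)
    {h : ℕ → ℕ → Bool} (e : Fin n ≃ W) (he : ∀ i j, H.Adj (e i) (e j) ↔ h i j = true) :
    H.IsIndContained G ↔ ∃ g, IsCopy G n h g := by
  constructor
  · rintro ⟨φ⟩
    -- Reduction modulo `n` only serves to define the map on all of `ℕ`.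
    have hm : ∀ i, i % n < n := fun i => Nat.mod_lt i hn
    refine ⟨fun i => φ (e ⟨i % n, hm i⟩), fun i hi j hj hij => ?_, fun i hi j hj => ?_⟩
    · have := congrArg Fin.val (e.injective (φ.injective hij))
      simpa [Nat.mod_eq_of_lt hi, Nat.mod_eq_of_lt hj] using this
    · rw [φ.map_adj_iff, he]
      simp only [Nat.mod_eq_of_lt hi, Nat.mod_eq_of_lt hj]
  · rintro ⟨g, h1, h2⟩
    refine ⟨⟨⟨fun w => g (e.symm w), fun v w hvw => ?_⟩, fun {v w} => ?_⟩⟩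
    · exact e.symm.injective (Fin.ext (h1 _ (Fin.is_lt _) _ (Fin.is_lt _) hvw))
    · have := he (e.symm v) (e.symm w)
      rw [e.apply_symm_apply, e.apply_symm_apply] at this
      rw [this]
      exact h2 _ (Fin.is_lt _) _ (Fin.is_lt _)

theorem pathGraph_isIndContained_iff :
    (SimpleGraph.pathGraph 5).IsIndContained G ↔ ∃ g, IsCopy G 5 pathAdj g :=
  isIndContained_iff_exists_copy (by omega) (Equiv.refl _) fun i j => by
    simp [SimpleGraph.pathGraph_adj, pathAdj]

theorem gem_isIndContained_iff : gem.IsIndContained G ↔ ∃ g, IsCopy G 5 gemAdj g :=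
  isIndContained_iff_exists_copy (by omega) (Equiv.refl _) fun i j => by
    have key : ∀ i j : Fin 5, (i ≠ j ∧ (((i : ℕ) + 1 = j ∨ j = 4) ∨ (j : ℕ) + 1 = i ∨ i = 4)) ↔
      gemAdj i j = true := by decide
    exact key i j

theorem coP3P2_isIndContained_iff : coP3P2.IsIndContained G ↔ ∃ g, IsCopy G 5 coAdj g :=
  isIndContained_iff_exists_copy (n := 3 + 2) (by omega) finSumFinEquiv.symm fun i j => by
    obtain ⟨x, rfl⟩ := finSumFinEquiv.surjective i
    obtain ⟨y, rfl⟩ := finSumFinEquiv.surjective j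
    rw [Equiv.symm_apply_apply, Equiv.symm_apply_apply, coP3P2, SimpleGraph.compl_adj]
    have h11 : ∀ a b : Fin 3, (a ≠ b ∧ ¬ ((a : ℕ) + 1 = b ∨ (b : ℕ) + 1 = a)) ↔
      coAdj a b = true := by decide
    have h22 : ∀ a b : Fin 2, (a ≠ b ∧ ¬ ((a : ℕ) + 1 = b ∨ (b : ℕ) + 1 = a)) ↔
      coAdj (3 + a) (3 + b) = true := by decide
    have h12 : ∀ (a : Fin 3) (b : Fin 2), coAdj a (3 + b) = true := by decide
    rcases x with a | a <;> rcases y with b | b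
    · change _ ↔ coAdj a b = true
      simpa [SimpleGraph.pathGraph_adj] using h11 a b
    · change _ ↔ coAdj a (3 + b) = true
      simpa using h12 a b
    · change _ ↔ coAdj (3 + a) b = true
      simpa [isSimple_coAdj.symm (3 + a)] using h12 b a
    · change _ ↔ coAdj (3 + a) (3 + b) = true
      simpa [SimpleGraph.pathGraph_adj] using h22 a b

theorem IsCritical.of_iso {H : SimpleGraph W} (hH : IsCritical H) (e : G ≃g H) : IsCritical G := by
  refine ⟨fun h => hH.not_colorable (h.of_hom e.symm.toHom), fun v => ?_⟩
  obtain ⟨c, hc⟩ := hH.exists_coloring (e v)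
  refine ⟨SimpleGraph.Coloring.mk (fun x => c (e x)) fun {x y} hxy => ?_⟩
  exact hc _ _ (fun h => x.2 (e.injective h)) (fun h => y.2 (e.injective h)) (e.map_adj_iff.2 hxy)

/-- The adjacency lists are symmetric and irreflexive, and have no entries out of range. -/
def wellFormed (L : List (List ℕ)) : Bool :=
  L.all (fun l => l.all fun j => Nat.ble (Nat.succ j) L.length) &&
  (List.range L.length).all fun i =>
    !listAdj L i i && (List.range L.length).all fun j => listAdj L i j == listAdj L j i

theorem isSimple_listAdj {L : List (List ℕ)} (hL : wellFormed L = true) : IsSimple (listAdj L) := by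
  simp only [wellFormed, Bool.and_eq_true, List.all_eq_true, List.mem_range, beq_iff_eq,
    Bool.not_eq_true', Nat.ble_eq] at hL
  obtain ⟨h1, h2⟩ := hL
  have hlt : ∀ i j, listAdj L i j = true → i < L.length ∧ j < L.length := by
    intro i j hij
    simp only [listAdj, List.any_eq_true, natBeq_iff, exists_eq_right'] at hij
    by_cases hi : i < L.length
    · rw [List.getD_eq_getElem _ _ hi] at hij
      exact ⟨hi, h1 _ (List.getElem_mem hi) j hij⟩
    · rw [List.getD_eq_default _ _ (by omega)] at hij
      simp at hij
  refine ⟨fun i j => ?_, fun i => ?_⟩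
  · by_cases h : i < L.length ∧ j < L.length
    · exact (h2 i h.1).2 j h.2
    · rw [Bool.eq_false_iff.2 fun h' => h (hlt i j h'),
        Bool.eq_false_iff.2 fun h' => h (hlt j i h').symm]
  · by_cases h : i < L.length
    · exact (h2 i h).1
    · exact Bool.eq_false_iff.2 fun h' => h (hlt i i h').1

theorem adjListGraph_adj {L : List (List ℕ)} (hL : wellFormed L = true) (i j : Fin L.length) :
    (adjListGraph L).Adj i j ↔ listAdj L i j = true := by
  have hs := isSimple_listAdj hL
  have e : ∀ i j : Fin L.length, (j : ℕ) ∈ L[i] ↔ listAdj L i j = true := by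
    intro i j
    simp [listAdj]
  rw [adjListGraph, SimpleGraph.fromRel_adj, e, e, hs.symm j i, or_self, and_iff_right_iff_imp]
  rintro h rfl
  rw [hs.irrefl] at h
  exact absurd h (by simp)

theorem hasCopy_of_isCopy {h : ℕ → ℕ → Bool} (hs : IsSimple h) {k : ℕ} {L : List (List ℕ)}
    (hL : wellFormed L = true) {g : ℕ → Fin L.length} (hg : IsCopy (adjListGraph L) k h g) :
    hasCopy h k (listAdj L) L.length = true :=
  hasCopy_of_copy hs (p := fun i => g i) (fun i _ => (g i).2)
    (fun i hi j hj e => hg.1 i hi j hj (Fin.ext e)) fun i hi j hj => by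
      rw [Bool.eq_iff_iff, ← hg.2 i hi j hj, adjListGraph_adj hL]

/-- The adjacency lists describe a critical graph without induced copies of the path and of `h`. -/
noncomputable def isGood (h : ℕ → ℕ → Bool) (L : List (List ℕ)) : Bool :=
  wellFormed L && !isColorable (listAdj L) L.length &&
  (List.range L.length).all (fun v => isColorableWithout (listAdj L) L.length v) &&
  !hasCopy pathAdj 5 (listAdj L) L.length && !hasCopy h 5 (listAdj L) L.length

variable {h : ℕ → ℕ → Bool} {L M : List (List ℕ)}

theorem isGood_iff : isGood h L = true ↔ wellFormed L = true ∧
    isColorable (listAdj L) L.length = false ∧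
    (∀ v < L.length, isColorableWithout (listAdj L) L.length v = true) ∧
    hasCopy pathAdj 5 (listAdj L) L.length = false ∧ hasCopy h 5 (listAdj L) L.length = false := by
  simp only [isGood, Bool.and_eq_true, Bool.not_eq_true', List.all_eq_true, List.mem_range,
    and_assoc]

/-- A colouring would make the complete search succeed, whereas the searches with a vertex left out
succeed and return colourings. -/
theorem isCritical_of_isGood (hL : isGood h L = true) : IsCritical (adjListGraph L) := by
  obtain ⟨hw, h1, h2, -, -⟩ := isGood_iff.1 hL
  refine ⟨fun ⟨c⟩ => ?_, fun v => ?_⟩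
  · rw [isColorable_of_coloring (χ := fun i => if hi : i < L.length then c ⟨i, hi⟩ else 0)] at h1
    · exact absurd h1 (by simp)
    · intro i hi j hj hij
      simp only [hi, hj, dite_true]
      exact c.valid ((adjListGraph_adj hw ⟨i, hi⟩ ⟨j, hj⟩).2 hij)
  · obtain ⟨χ, hχ⟩ := exists_coloring_of_isColorableWithout (h2 v v.2)
    refine ⟨SimpleGraph.Coloring.mk (fun x => χ x.1) fun {x y} hxy => ?_⟩
    exact hχ _ x.1.2 _ y.1.2 (fun e => x.2 (Fin.ext e)) (fun e => y.2 (Fin.ext e))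
      ((adjListGraph_adj hw _ _).1 hxy)

theorem not_isCopy_of_isGood (hh : IsSimple h) (hL : isGood h L = true) :
    (¬ ∃ g, IsCopy (adjListGraph L) 5 pathAdj g) ∧ ¬ ∃ g, IsCopy (adjListGraph L) 5 h g := by
  obtain ⟨hw, -, -, h1, h2⟩ := isGood_iff.1 hL
  refine ⟨fun ⟨g, hg⟩ => ?_, fun ⟨g, hg⟩ => ?_⟩
  · rw [hasCopy_of_isCopy isSimple_pathAdj hw hg] at h1
    exact absurd h1 (by simp)
  · rw [hasCopy_of_isCopy hh hw hg] at h2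
    exact absurd h2 (by simp)

/-- A critical graph has no proper induced subgraphs which are critical. -/
theorem nonempty_iso_of_isCopy (hG : IsCritical G) (hw : wellFormed L = true)
    (hL : IsCritical (adjListGraph L)) {g : ℕ → V} (hg : IsCopy G L.length (listAdj L) g) :
    Nonempty (G ≃g adjListGraph L) := by
  let φ : adjListGraph L ↪g G := ⟨⟨fun i => g i, fun i j hij => Fin.ext (hg.1 _ i.2 _ j.2 hij)⟩,
    fun {i j} => (hg.2 _ i.2 _ j.2).trans (adjListGraph_adj hw i j).symm⟩
  have hφ : Function.Surjective φ := by
    by_contra hs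
    rw [Function.Surjective] at hs
    push Not at hs
    obtain ⟨v, hv⟩ := hs
    -- If the copy misses `v`, a colouring of `G - v` colours the listed graph.
    obtain ⟨c, hc⟩ := hG.exists_coloring v
    exact hL.false_of_coloring (fun i => c (φ i)) fun i j hij =>
      hc _ _ (hv i) (hv j) (φ.map_adj_iff.2 hij)
  exact ⟨(RelIso.ofSurjective φ hφ).symm⟩

/-- The graphs have different sizes, or the first has no induced copy in the second. -/
noncomputable def areDistinct (L M : List (List ℕ)) : Bool :=
  !Nat.beq L.length M.length || !hasCopy (listAdj L) L.length (listAdj M) M.length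

/-- An isomorphism preserves the size and is in particular an induced copy of one graph in the
other. -/
theorem isEmpty_iso_of_areDistinct (hL : wellFormed L = true) (hM : wellFormed M = true)
    (hpos : 0 < L.length) (h : areDistinct L M = true) :
    IsEmpty (adjListGraph L ≃g adjListGraph M) := by
  refine ⟨fun e => ?_⟩
  rw [areDistinct, Bool.or_eq_true, Bool.not_eq_true', Bool.not_eq_true', ← Bool.not_eq_true,
    natBeq_iff] at h
  rcases h with h | h
  · exact h (by simpa using Fintype.card_congr e.toEquiv)
  · obtain ⟨g, hg⟩ := (isIndContained_iff_exists_copy hpos (Equiv.refl _)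
      (adjListGraph_adj hL)).1 ⟨e.toEmbedding⟩
    rw [hasCopy_of_isCopy (isSimple_listAdj hL) hM hg] at h
    exact absurd h (by simp)

/-- The conclusion of the classification from certificates. -/
theorem critical_iff_of_certificates {H : SimpleGraph W} (hh : IsSimple h)
    {Ls : List (List (List ℕ))} (hmem : completeList ∈ Ls) (hgood : Ls.all (isGood h) = true)
    {l : List (ℕ × List ℕ)} {k : List ℕ}
    (hl : stages (killTree (codeTable [pathAdj, h, complAdj])) Ls
      (typesOf (killTree (codeTable [pathAdj, h, complAdj])) cycRows) l [] = true)
    (hk : (check (killTree (codeTable [pathAdj, h, complAdj, cycAdj])) Ls 30 [0]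
      (typesOf (killTree (codeTable [pathAdj, h, complAdj, cycAdj])) [0]) k).isSome = true)
    (hH : H.IsIndContained G ↔ ∃ g, IsCopy G 5 h g)
    (hH' : ∀ {L : List (List ℕ)}, H.IsIndContained (adjListGraph L) ↔
      ∃ g, IsCopy (adjListGraph L) 5 h g) :
    (IsVertexCritical 5 G ∧ IsPairFree (SimpleGraph.pathGraph 5) H G) ↔
      ∃ L ∈ Ls, Nonempty (G ≃g adjListGraph L) := by
  rw [List.all_eq_true] at hgood
  rw [isVertexCritical_five_iff, IsPairFree]
  constructor
  · rintro ⟨hG, hP, hFree⟩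
    rw [pathGraph_isIndContained_iff] at hP
    rw [hH] at hFree
    obtain ⟨L, hL, g, hg⟩ := exists_copy_of_certificates hG hh hP hFree hmem hl hk
    exact ⟨L, hL, nonempty_iso_of_isCopy hG (isGood_iff.1 (hgood L hL)).1
      (isCritical_of_isGood (hgood L hL)) hg⟩
  · rintro ⟨L, hL, ⟨e⟩⟩
    obtain ⟨h1, h2⟩ := not_isCopy_of_isGood hh (hgood L hL)
    have hi : G.IsIndContained (adjListGraph L) := ⟨e.toEmbedding⟩
    exact ⟨(isCritical_of_isGood (hgood L hL)).of_iso e,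
      fun hP => h1 (pathGraph_isIndContained_iff.1 (hP.trans hi)),
      fun hP => h2 (hH'.1 (hP.trans hi))⟩

theorem pairwise_isEmpty_iso {Ls : List (List (List ℕ))} (hgood : Ls.all (isGood h) = true)
    (hpos : ∀ L ∈ Ls, 0 < L.length) (hd : Ls.Pairwise fun L M => areDistinct L M = true) :
    Ls.Pairwise fun L M => IsEmpty (adjListGraph L ≃g adjListGraph M) := by
  rw [List.all_eq_true] at hgood
  refine hd.imp_of_mem fun {L M} hL hM hLM => ?_
  exact isEmpty_iso_of_areDistinct (isGood_iff.1 (hgood L hL)).1 (isGood_iff.1 (hgood M hM)).1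
    (hpos L hL) hLM

/-- Taking isomorphism classes maps the list onto the critical classes by `hiff`, and is injective
by `hd`. -/
theorem encard_criticalClasses {W₁ W₂ : Type*} {k : ℕ} {H₁ : SimpleGraph W₁} {H₂ : SimpleGraph W₂}
    {Ls : List (List (List ℕ))}
    (hiff : ∀ (V : Type) [Finite V] (G : SimpleGraph V),
      (IsVertexCritical k G ∧ IsPairFree H₁ H₂ G) ↔ ∃ L ∈ Ls, Nonempty (G ≃g adjListGraph L))
    (hd : Ls.Pairwise fun L M => IsEmpty (adjListGraph L ≃g adjListGraph M)) :
    (criticalClasses k H₁ H₂).encard = Ls.length := by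
  classical
  have hclass : ∀ {m n : ℕ} {G : SimpleGraph (Fin m)} {H : SimpleGraph (Fin n)},
      isoClass G = isoClass H ↔ Nonempty (G ≃g H) := fun {_ _ _ _} => Quotient.eq
  have himage : criticalClasses k H₁ H₂ =
      (fun L => isoClass (adjListGraph L)) '' (Ls.toFinset : Set (List (List ℕ))) := by
    ext c
    simp only [criticalClasses, Set.mem_ofPred_eq, Set.mem_image, List.coe_toFinset]
    constructor
    · rintro ⟨n, G, rfl, hG⟩
      obtain ⟨L, hL, ⟨e⟩⟩ := (hiff _ G).1 hG
      exact ⟨L, hL, hclass.2 ⟨e.symm⟩⟩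
    · rintro ⟨L, hL, rfl⟩
      exact ⟨_, adjListGraph L, rfl, (hiff _ _).2 ⟨L, hL, ⟨SimpleGraph.Iso.refl⟩⟩⟩
  -- A repeated entry would be isomorphic to itself by the identity.
  have hnodup : Ls.Nodup := hd.imp fun {L M} hLM e => by
    subst e
    exact hLM.false SimpleGraph.Iso.refl
  have hinj : Set.InjOn (fun L => isoClass (adjListGraph L))
      (Ls.toFinset : Set (List (List ℕ))) := by
    intro L hL M hM e
    obtain ⟨e⟩ := hclass.1 e
    by_contra hne
    rw [List.coe_toFinset] at hL hM
    have : Std.Symm fun L M => IsEmpty (adjListGraph L ≃g adjListGraph M) :=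
      ⟨fun L M h => ⟨fun e => h.false e.symm⟩⟩
    exact (hd.forall hL hM hne).false e
  rw [himage, hinj.encard_image, Set.encard_coe_eq_coe_finsetCard,
    List.toFinset_card_of_nodup hnodup]

end Transfer

/-! ### The case of the gem -/

/-- Certificates for the types on an induced `5`-cycle; the excluded graph is the gem. -/
def gemCycleHints : List (ℕ × List ℕ) := [
  (11,
    [24, 6282, 4298, 8526066, 9450, 7466, 11773266, 12622, 12526, 9354, 4394, 11674962, 12622,
     12430, 48, 10506, 8522, 12855666, 13678, 13582, 10880260410, 11566, 4458, 12725494, 10314,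
     16, 12650, 1299257806565639, 1299120367612167, 1418, 1299258091290891, 12330,
     1298991401017483, 1298987106050187, 12398, 334, 10254, 10346, 3406, 9290, 7541010, 11530,
     8554, 13905298, 14734, 14606, 11466, 6506, 13839762, 14734, 14542, 16, 12618,
     1585126535082247, 1584989096128775, 1418, 1585126827933963, 12330, 1584726993674379,
     1584722698707083, 12398, 8266, 48, 10506, 8522, 12855666, 13678, 13582, 330, 16, 12586,
     1870712071692811, 1729974583337483, 12394, 1588712971714959, 1588708676747663, 12330,
     1026312781734031, 1026308486766735, 10250, 330, 12593522, 13678, 13326, 16, 11562,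
     1729437444227083, 1588699955871755, 11370, 1447971187081615, 1447966892114319, 1386,
     1299116487651343, 11310, 32, 11498, 7530, 13872530, 14734, 14574, 10559794, 12586,
     1580724193341703, 12362, 1580724193341703, 1580586754388231, 11374, 10346, 3402, 12691826,
     13678, 13422, 10488882, 1386, 1039353497792783, 11306, 1039352155615503, 1034954109104399,
     7242, 4298, 48, 10538, 9546, 12888434, 13678, 13614, 16, 11530, 1448641064349959,
     1448503625396487, 1386, 1448641357197579, 11306, 1448108378955915, 1448104083988619, 11374,
     330, 16, 12554, 1866322615116555, 1725585126761227, 12394, 1584589803118991,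
     1584585508151695, 12330, 1303389712195727, 1303385417228431, 10250, 330, 12593522, 13678,
     13326, 16, 11530, 1725314275631115, 1584576787275787, 11370, 1443848018485647,
     1443843723518351, 1386, 1167175360753679, 11310, 10346, 3402, 12691826, 13678, 13422,
     10488882, 1386, 1320824179798287, 11306, 1320822837621007, 1316424791109903, 2250, 6218,
     8330, 72, 48, 11498, 1721049235075591, 1386, 1448637053842187, 1580311746720263, 11306,
     1447970931630219, 1447966636662923, 11374, 330, 48, 12522, 1861924585382411,
     1721187097027083, 12394, 1580192293470607, 1580187998503311, 12330, 1298992202293391,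
     1298987907326095, 10250, 330, 12593522, 13678, 13326, 48, 11498, 1720916245889035,
     1580178757533707, 11370, 1439450508837263, 1439446213869967, 1386, 1026437604487183, 11310,
     10346, 3402, 12691826, 13678, 13422, 10488882, 1386, 1729437839548815, 11306,
     1729437838238095, 1588700349882767, 8587506, 9450, 7466, 11773266, 12622, 12526, 9418,
     6442, 11740498, 12622, 12494, 16, 10506, 8522, 12855666, 13678, 13582, 10947365178, 11566,
     6506, 12791030, 1358, 10286, 10346, 3406, 6314, 5194, 5258, 234, 64, 72, 1729978601844999,
     12298, 1584589672169483, 1584585377202187, 12398, 11306, 5326, 5326, 11370, 3434, 13741458,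
     14734, 14446, 11537458, 12298, 1866056188576143, 1725318700220815, 1152146, 5322, 9607410,
     10478, 10414, 5194, 5322, 10655986, 11502, 11438, 64, 5194, 5322, 11704562, 12526, 12462,
     7411026, 11594, 1303514119155975, 1303376680202503, 5322, 10655986, 11502, 11438, 9230,
     9322, 7476498, 11534, 7476498, 10510, 5322, 9607410, 10478, 10414, 5262, 16, 5258, 1258,
     56, 10538, 9546, 12888434, 13678, 13614, 64, 1448503902339591, 3434, 1448640959001099,
     11370, 1448108651200907, 1448104356233611, 11278, 64, 1584577063710987, 11274,
     1443848295575567, 1443844000608271, 3434, 1167175482650895, 11374, 10250, 330, 12593522,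
     13678, 13326, 10551410, 3434, 1729575689535503, 11370, 1729575688486927, 1588838200131599,
     7370, 6378, 9641234, 10510, 10446, 7210, 1258, 9477394, 10510, 10286, 5258, 5435917530,
     9574674, 10506, 8522, 12855666, 13678, 13582, 32950561, 11502, 11566, 11598, 362,
     1080305479097460110103, 3438, 11374, 366, 11278, 16732705, 11502, 11566, 11594, 3434,
     13970834, 14734, 14670, 11374, 11278, 108448033, 12654, 16732705, 12654, 298, 72, 11594,
     10602, 13970834, 14734, 14670, 64, 1823098541883066417299, 12394, 1085228629839180743063,
     1085228629834885775767, 12302, 64, 1443826288173195, 330, 1167024500285583, 39834145,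
     12302, 12398, 12526, 12654, 12590, 12622, 12558, 10254, 3402, 1158236850397455, 10350,
     9322, 3370, 11642194, 12622, 12398, 7784737, 10478, 3402, 9768306, 12654, 12622, 32950561,
     12590, 12302, 12654, 12622, 12558, 10542, 330, 1026291436528143, 10254, 10510, 6282,
     5503190330, 10538, 9546, 12888434, 13678, 13614, 10506, 8522, 12855666, 13678, 13582,
     27742753, 11370, 3434, 13741458, 14734, 14446, 128406049, 12654, 12302, 12526, 12622,
     11278, 11502, 128406049, 12654, 12622, 11598, 94884385, 12654, 27619873, 11370, 3434,
     13741458, 14734, 14446, 124176673, 12654, 12302, 12622, 12526, 11278, 128283169, 12654,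
     12622, 12526, 11598, 11502, 124176673, 12654, 32, 8426, 7434, 10723634, 11562, 5262, 11498,
     5262, 5262, 8202, 266, 10494258, 11566, 11278, 1790497, 9486, 9322, 3370, 11642194, 12622,
     12398, 5258, 8081953, 11566, 11594, 10602, 13970834, 14734, 14670, 108745249, 12654,
     108745249, 12654, 100190497, 12654, 3306, 9670002, 12654, 5258, 5435917530, 106101793,
     12654, 12622, 12590, 106101793, 12590, 12654, 12622, 5435917530, 1316425470722063,
     1584576648737295, 3306, 8081953, 11566, 11594, 10602, 13970834, 14734, 14670, 108745249,
     12654, 108325921, 12654, 5435917530, 26536993, 11598, 127200289, 12654, 12590, 11562, 9578,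
     13938066, 14734, 14638, 93518881, 12654, 3310, 3310, 8298, 3338, 9440306, 3227551930,
     10592562, 13614, 13422, 8391730, 3227551930, 25940257, 11562, 9578, 13938066, 14734, 14638,
     11598, 93051169, 12654, 12558, 126603553, 12654, 12558, 11534, 63559969, 12654, 3227551930,
     9573650, 10506, 3310, 3310, 8081953, 11566, 108745249, 12654, 12622, 11598, 108745249,
     12654, 5258, 3227551930, 5435917530, 132698401, 12622, 12654, 12590, 12558, 130603297,
     12622, 12654, 12558, 12590, 3227551930, 5504205082, 10506, 8522, 12855666, 13678, 13582,
     31674913, 11566, 132338209, 12654, 12622, 11598, 123918625, 12654, 6282, 7379122, 7477522,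
     10506, 8522, 12855666, 13678, 13582, 32950561, 11566, 11502, 11598, 362,
     1080305888115655750299, 366, 11278, 11374, 6282, 3227551930, 9573650, 10506, 8522,
     12855666, 13678, 13582, 32950561, 11566, 11502, 11598, 362, 1080305888115655750295, 366,
     11278, 11374, 330, 108448033, 12590, 12526, 394, 13971826, 14702, 14670, 12302, 12398,
     12654, 12622, 298, 72, 11594, 10602, 13970834, 14734, 14670, 64, 1823098401282870227219,
     12298, 1085228766178492956695, 1085228766174197989399, 12398, 9226, 298, 11543890, 12622,
     12302, 6220833, 10478, 330, 9765234, 12654, 12622, 10542, 10350, 10510, 7274, 6282, 3306,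
     10591506, 11534, 11374, 6282, 7343154, 298, 3227551930, 1456883648053647, 11274, 362,
     12878162, 14670, 14638, 11829586, 12622, 12590, 9226, 298, 11543890, 12622, 12302, 7784737,
     330, 80, 12650, 1094600756985871089691, 1089989070967443701787, 10542, 10478, 10510, 16,
     7370, 6378, 9641234, 10510, 10446, 5258, 1258, 40, 10622226, 11530, 1725297372197131,
     1584559883841803, 33247777, 12622, 12654, 12302, 1418, 13873458, 14638, 14574, 12590,
     12526, 12334, 12398, 10282, 1354, 11765042, 13614, 13550, 10716466, 11566, 11502, 10346,
     1167020863795471, 1166883424841999, 10250, 880894047186959, 880889752219663, 9322,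
     9671051450, 1386, 1180078101246223, 11306, 1180076759068943, 1175678712557839, 11274,
     1716380873277839, 1575643384922511, 11670802, 12558, 9671051450, 11274, 362, 13643154,
     14734, 14350, 73133089, 12622, 12654, 12590, 12398, 12334, 12558, 12526, 104813089, 12622,
     12654, 12558, 12526, 12590, 12334, 12398, 11306, 1386, 13675922, 14734, 14382, 104813089,
     12590, 12654, 12398, 12558, 12526, 12622, 1179779354, 9482, 8490, 11806034, 12622, 12558,
     9322, 3370, 11642194, 12622, 12398, 1258, 31674913, 11274, 362, 13643154, 14734, 14350,
     132338209, 12654, 12622, 12590, 12334, 12526, 11598, 11306, 1386, 13675922, 14734, 14382,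
     132338209, 12654, 12590, 12526, 11566, 11502, 104583457, 12654, 8593117370, 11306, 1386,
     12813650, 14670, 14574, 11765074, 12622, 12526, 1593356497596687, 11274, 1729832857661711,
     1589095369306383, 1258, 31674913, 11274, 362, 13643154, 14734, 14350, 132338209, 12654,
     12622, 12590, 12334, 12526, 11598, 11566, 11306, 1386, 13675922, 14734, 14382, 82178593,
     12654, 12526, 115724833, 12654, 12526, 11502, 9511126, 5258, 266, 64, 10538,
     1588683053469959, 1447945565114631, 1012831009014283, 10286, 10350, 9326, 64,
     1302809744519431, 9666859194, 27218465, 11598, 11502, 11566, 11534, 11278, 3438, 1386,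
     1213747549476859589271, 11310, 11374, 10250, 1012697596837899, 1012693301870603, 1354, 80,
     12650, 1094600620779434684947, 12590, 1089988934761007297043, 10286, 9226,
     1012693301870603, 1012689006903307, 9326, 32, 9482, 8490, 11806034, 12622, 12558, 9226,
     298, 11543890, 12622, 12302, 1179779354, 31937057, 11566, 11502, 3438, 11598, 1386,
     1361321229388171883543, 11374, 11310, 1354, 80, 12650, 1094601042446984155155,
     1089989356428556767251, 10350, 3374, 9445554, 31937057, 11598, 11502, 11566, 1386,
     1361321502066535871131, 11310, 11374, 9326, 7210, 1258, 9477394, 10510, 10286, 7439506, 64,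
     1302676482957451, 9322, 1158086526513423, 3370, 1158223965491471, 1157949087559951, 298,
     1153692921794703, 2052641, 10542, 10254, 10510, 1354, 80, 12650, 1242175131504418889879,
     1237563445485991501975, 10478, 9230, 8298, 3338, 10592562, 11566, 11374, 9702738, 12622,
     12558, 5504237914, 362, 1320270145396879, 11594, 1320270011179151, 11534, 1315871964668047,
     3338, 1179779386, 362, 1461007634407567, 11562, 1461007365972111, 11374, 1456609319461007,
     5258, 298, 1170736295583887, 2052641, 10254, 10542, 1354, 80, 12650,
     1242175131504418889883, 1237563445485991501979, 10478, 10510, 7274, 3306, 0, 64, 132338209,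
     394, 96, 14762, 2169499835461899, 2028762347106571, 8586, 13906290, 14702, 14606, 394,
     13644114, 14670, 14350, 12622, 3466, 13873458, 14638, 14574, 12590, 12654, 12526, 12302,
     12558, 12398, 11370, 3434, 12815666, 14638, 14574, 11767090, 12590, 12526, 889689594950159,
     10556630, 8593117370, 362, 898482869400079, 11278, 3306, 0, 26956321, 362, 88, 13706,
     2024226857431307, 1883489369075979, 1435584501399951, 362, 12594514, 13646, 13326, 11598,
     3434, 12692754, 13582, 13422, 11534, 11562, 9578, 13938066, 14734, 14638, 11374, 11498,
     12688662, 127619617, 12654, 12302, 11640086, 11278, 1435309623493007, 10556630, 9671053498,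
     362, 1716647162691983, 11278, 9542930, 10510, 10350, 0, 5258, 298, 72, 11594,
     1733818340356363, 1593080852001035, 1153830351815055, 2052641, 330, 11544850, 12558, 12302,
     10510, 10542, 10254, 1354, 80, 12650, 1242174586147171344791, 1237562900128743956887,
     10478, 1153555473908111, 7343154, 298, 1434893012844943, 9230, 8459478, 5194, 32, 8394,
     6410, 10690866, 11566, 11470, 1258, 56, 10538, 1588820483899911, 1448082995544583, 10254,
     10350, 9326, 8298, 1258, 56, 11594, 1733693911613835, 1592956423258507, 11274,
     1311494981959695, 1311490686992399, 3338, 12689714, 13614, 13422, 3338, 11641138, 12590,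
     12398, 5309682, 7466, 72, 11594, 1733689625035147, 1592952136679819, 1592952136679819,
     11274, 1170757762039823, 1170753467072527, 9450, 12885330, 13614, 72, 1447816593424779,
     10250, 1166355152125967, 1166350857158671, 8, 108742945, 1418, 13676914, 14702, 14382,
     12654, 12558, 12622, 12590, 12334, 11670742, 5437096250, 10538, 9546, 11642130, 13582,
     10593554, 11534, 8266, 5437096250, 10538, 9546, 12888434, 13678, 13614, 26954017, 11534,
     11274, 362, 13643154, 14734, 14350, 127617313, 12654, 12622, 12334, 12526, 11306, 1386,
     13675922, 14734, 14382, 109564705, 12654, 12622, 12526, 11598, 109564705, 12654, 12526,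
     11502, 10474, 7498, 12822898, 13678, 13550, 9671051450, 11306, 1386, 13675922, 14734,
     14382, 128307745, 12654, 12622, 12558, 12302, 128307745, 12654, 12622, 12558, 12302, 11274,
     362, 13643154, 14734, 14350, 96726049, 12558, 12654, 12622, 8202, 266, 9502834, 11374,
     8454258, 9326, 8302, 5194, 6218, 5437096218, 9482, 8490, 11806034, 12622, 12558, 9450,
     7466, 11773266, 12622, 12526, 1179779290, 10346, 3402, 12691826, 13678, 13422, 32264737,
     11306, 1386, 13675922, 14734, 14382, 132928033, 12654, 12622, 12590, 12302, 12494, 11598,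
     11274, 362, 13643154, 14734, 14350, 132928033, 12654, 12590, 12494, 11566, 11470,
     111630625, 12654, 10442, 6474, 12790130, 13678, 13518, 32264737, 11274, 362, 13643154,
     14734, 14350, 132928033, 12654, 12622, 12590, 12334, 11598, 11566, 119954209, 12654, 12334,
     11306, 1386, 13675922, 14734, 14382, 119954209, 12654, 1179779290, 10346, 3402, 12691826,
     13678, 13422, 31085089, 11306, 1386, 13675922, 14734, 14382, 131748385, 12654, 12622,
     12590, 12302, 12494, 11598, 11566, 11274, 362, 13643154, 14734, 14350, 131748385, 12654,
     12494, 115562785, 12654, 12494, 11470, 10442, 6474, 12790130, 13678, 13518, 8597309626,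
     123886369, 12654, 12622, 12590, 12302, 12334, 11274, 362, 13643154, 14734, 14350,
     131748385, 12654, 12622, 12334, 12590, 11306, 1386, 13675922, 14734, 14382, 123886369,
     12654, 12590, 12622, 5194, 5262, 5194, 5262]),
  (7,
    [8, 6314, 5322, 8558834, 9454, 9390, 24, 7306, 32, 9482, 1443405645742215, 1302668157386887,
     9322, 867557896634763, 1302668157386887, 867553601667467, 9230, 24, 8426, 1298270110875783,
     8270, 1157532622520455, 867411867746699, 24, 8426, 1298269846511751, 1157532358156423,
     8270, 7246, 6218, 2250, 8330, 32, 10538, 1588678355198091, 1447940866842763, 10250,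
     1025479826214927, 1025475531247631, 10346, 1290169655767311, 1290032216813839, 8460530,
     9454, 9294, 8202, 5342354, 10346, 1588678355198095, 1447940866842767, 10378,
     1034267329302543, 1029869282791439, 32, 32, 8426, 1298269846511755, 1157532358156427, 8202,
     875937654902799, 875933359935503, 8298, 1008415506182415, 1008278067228943, 7178, 24, 9422,
     1302667893022863, 9358, 24, 8398, 1157532358156431, 8334, 7274, 6293650, 9358, 32, 8430,
     6154, 202, 8298, 24, 10538, 1588412599767051, 1447675111411723, 10378, 1290169664028687,
     1290032225075215, 8394994, 9454, 9230, 24, 24, 8426, 1298137235066891, 1157399746711563,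
     8330, 1008415514443791, 1008278075490319, 7306, 6357106, 9326, 24, 8430]),
  (5,
    [5166])]

/-- Certificate for graphs without induced `5`-cycles; the excluded graph is the gem. -/
def gemHints : List ℕ :=
  [0, 8, 74, 24, 2058, 4170, 1130, 2186, 1226, 8392882, 10410, 5450, 12757362, 13678, 13486,
   10250, 330, 12593522, 13678, 13326, 0, 11598, 11306, 1390, 1390, 1390, 11310, 10314, 11667730,
   12558, 12430, 9258, 8392882, 11438, 11278, 8266, 1226, 7540050, 11598, 11470, 7210, 1226, 2186,
   10490034, 11438, 11278, 10314, 11536562, 12462, 12302, 1130, 2186, 8392882, 9386, 5418,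
   11707730, 12622, 12462, 9226, 298, 11543890, 12622, 12302, 0, 10542, 1358, 10282, 1358, 1358,
   6293682, 7338, 5354, 9608466, 10510, 10414, 7178, 234, 9444626, 10510, 10254, 40, 8430, 2186,
   0, 10286, 2186, 9507026, 10446, 10318, 8234, 1294, 1294, 1294, 4, 8238, 2186, 8458450, 9418,
   1134, 9290, 1134, 1134, 7310, 4170, 2186, 7409874, 8394, 1134, 8266, 1134, 1134, 1130, 1290,
   6424818, 11502, 11406, 5262, 5198, 4170, 40, 40, 7374, 48, 8302, 8366, 0, 8430, 8334, 8238,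
   7278, 40, 7374, 512545, 8430, 8302, 8334, 8238, 8366, 8206, 7278, 40, 7374, 0, 8430, 8334,
   8238, 7278, 0, 7374, 7310, 7214, 6250, 3274, 8493298, 9454, 9326, 40, 7374, 0, 6282, 4298,
   8526066, 9454, 9358, 6314, 5322, 8558834, 9454, 9390, 48, 7214, 7182, 6186, 1226, 8427762,
   9454, 9262, 6390962, 512545, 8398, 8430, 8302, 8206, 7274, 3306, 9542930, 10510, 10350, 512545,
   8398, 8430, 8206, 6361266, 512545, 8398, 8430, 8206, 8302, 512545, 8398, 8430, 8206, 8302,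
   6329494, 24, 512545, 8430, 266, 9445586, 10446, 10254, 8398, 8206, 8302, 512545, 266, 9445586,
   10446, 10254, 8398, 3338, 9543922, 10478, 10350, 8430, 8206, 8302, 1130, 5245074, 234, 56,
   9482, 8490, 11806034, 12622, 12558, 56, 10542, 10378, 4430, 4430, 1278226, 10478, 56, 10538,
   9550, 7178, 234, 9444626, 10510, 10254, 56, 8234, 1294, 8334, 7306, 8458418, 9390, 7409842,
   8366, 24, 5258, 4266, 7476434, 8398, 8334, 24, 6318, 24, 6314, 5326, 24, 6314, 5326, 24, 2058,
   5258, 4266, 8525042, 9454, 9358, 4138, 6357106, 1290, 5258, 330, 4266, 12621042, 13550, 13358,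
   12426, 13668594, 14574, 14382, 10522866, 11502, 11310, 8302, 5258, 4270, 24, 6314, 5326, 24,
   6314, 5326, 1134, 24, 3082, 1162, 2229458, 7370, 6378, 9641234, 10510, 10446, 7306, 4330,
   9575698, 10510, 10382, 3306, 8395954, 9386, 5418, 11707730, 12622, 12462, 9226, 298, 11543890,
   12622, 12302, 0, 10542, 1358, 1354, 10286, 32, 8430, 8298, 3342, 3342, 16, 5162, 3082, 1162,
   202, 7405682, 10314, 1198, 1198, 10346, 1198, 1198, 3082, 1194, 8426706, 9422, 9262, 1194,
   8426706, 9422, 9262, 1162, 7405682, 9294, 9326, 16, 6318, 40, 7278, 7246, 388129, 8430, 8398,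
   8334, 8206, 93217, 7370, 6378, 8427634, 10350, 7278, 7306, 4330, 9575698, 10510, 10382, 2282,
   8461490, 9294, 56, 8206, 7178, 234, 9444626, 10510, 10254, 486433, 8430, 8270, 486433, 8430,
   8270, 7246, 7379062, 6254, 16, 6314, 5326, 5375186, 7370, 6378, 9641234, 10510, 10446, 7306,
   4330, 9575698, 10510, 10382, 56, 8206, 486433, 8302, 8430, 8270, 8206, 486433, 8430, 8270,
   8302, 8206, 6254, 5406523514, 6250, 3274, 8493298, 9454, 9326, 6294706, 7338, 5354, 9608466,
   10510, 10414, 56, 8206, 8334, 7178, 234, 9444626, 10510, 10254, 511009, 8398, 8430, 8270, 8334,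
   511009, 8398, 8430, 8334, 8270, 6222, 5226, 3082, 3242, 8492242, 9422, 9326, 1162, 6294770,
   9454, 9230, 16, 6314, 5326, 4170, 16, 6314, 5326, 2058, 2186, 8458418, 9294, 1226, 5245170,
   9454, 9230, 6254, 6186, 1230, 1230, 2058, 1194, 4138, 1162, 234, 3377458, 10538, 9546,
   12888434, 13678, 13614, 10474, 7498, 12822898, 13678, 13550, 56, 11598, 11306, 1390, 1390,
   1390, 11310, 10250, 11599986, 12398, 9226, 10551410, 11374, 8234, 234, 3377490, 11598, 11502,
   1162, 8556754, 9418, 6442, 11740498, 12622, 12494, 9386, 5418, 11707730, 12622, 12462, 40,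
   10542, 334, 10250, 334, 334, 40, 8394, 6410, 10690866, 11566, 11470, 40, 9486, 9226, 302, 302,
   302, 1162, 40, 10510, 10254, 8330, 9474290, 10478, 10286, 7505106, 9390, 40, 9482, 8494, 4138,
   1162, 8425714, 9454, 9262, 4138, 6282, 8425714, 9454, 9262, 298, 7472402, 11534, 11406, 6190,
   1162, 3147954, 7338, 5354, 9608466, 10510, 10414, 56, 8234, 1294, 8206, 7178, 8454258, 9326,
   7405682, 8302, 3147954, 6314, 5322, 8558834, 9454, 9390, 40, 48, 8334, 8206, 7374, 7306, 4334,
   474145, 8430, 8206, 8238, 2314, 9511026, 10350, 8302, 7182, 6154, 4138, 202, 9443570, 10478,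
   10254, 202, 9443570, 10478, 10254, 7405682, 9326, 40, 511009, 8430, 8398, 8334, 2314, 9511026,
   10350, 8302, 8238, 7370, 6382, 7306, 4334, 5308530, 1226, 3147954, 8362, 4138, 1166, 4138,
   1166, 8202, 4138, 1166, 4138, 1166, 1162, 3147954, 8366, 8206, 6250, 4138, 1166, 4138, 1166,
   24, 5258, 4270, 24, 5258, 4270, 8, 3146, 24, 24, 6318, 40, 234, 8395826, 9262, 7214, 7278, 32,
   8430, 8398, 8270, 138, 32, 8426, 7434, 10723634, 11566, 11502, 32, 9486, 9290, 2350, 2350,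
   2350, 2350, 202, 9443378, 10286, 8394, 32, 10506, 8526, 10314, 2382, 1179890, 9358, 32, 9482,
   8494, 202, 8394802, 9262, 7370, 8394802, 9262, 2346, 1245458, 11534, 11470, 6190, 32, 7370,
   2314, 6378, 10492982, 10492982, 8394806, 7242, 266, 2282, 10591410, 11374, 10314, 11634866,
   12398, 8489138, 9326, 32, 8430, 32, 8426, 7438, 7346230, 2154, 170, 6218, 138, 2282, 1179954,
   11566, 11406, 6218, 7345202, 9262, 7345202, 9262, 138, 1179954, 10542, 10382, 5162, 2158, 2158,
   24, 6314, 5326, 1179858, 7370, 6378, 9641234, 10510, 10446, 56, 8270, 8334, 451873, 8430, 8270,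
   8302, 8334, 7306, 4330, 9575698, 10510, 10382, 255265, 8302, 8430, 8270, 2158, 32, 4202, 170,
   4294866, 8398, 8302, 266, 1311026, 10542, 10510, 5198, 16, 4202, 202, 8394802, 9262, 202,
   8394802, 9262, 170, 7408786, 9358, 6190, 6286, 1212626, 7370, 6378, 9641234, 10510, 10446,
   7338, 5354, 9608466, 10510, 10414, 56, 8302, 433441, 8430, 8302, 236833, 8430, 8302, 170, 2154,
   2250, 234, 4393234, 10506, 8522, 12855666, 13678, 13582, 10442, 6474, 12790130, 13678, 13518,
   48, 11598, 11434, 5486, 5486, 5486, 11438, 10346, 11603090, 12430, 9386, 10490930, 11310, 8298,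
   234, 9505938, 11406, 2250, 4294898, 9450, 7466, 11773266, 12622, 12526, 9322, 10554514, 11406,
   72, 5454, 10410, 5454, 9505938, 10382, 7408786, 2250, 266, 4294898, 11502, 11374, 8334,
   1212626, 7370, 6378, 9641234, 10510, 10446, 7338, 8393778, 9262, 56, 8298, 3342, 7345202, 8238,
   2154, 1212626, 8394, 6414, 234, 2314, 6296626, 11310, 2410, 4557202, 13710, 13678, 8366, 234,
   2314, 4458834, 11598, 11534, 1212626, 8398, 8366, 7408786, 266, 4294898, 10478, 10350, 8334,
   5166, 8, 4202, 3214]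

-- One neighbour on the cycle, or two consecutive ones, give an induced `P₅`; four or five give a
-- gem. Up to symmetry this leaves the types `11`, `7` and `5`, that is `{0, 1, 3}`, `{0, 1, 2}` and
-- `{0, 2}`, besides `0`. The last one needs a single rule: such a vertex has the same neighbours on
-- the cycle as vertex `1`, but no surviving type distinguishes the two.
set_option maxRecDepth 100000 in
theorem stages_gemCycleHints : stages (killTree (codeTable [pathAdj, gemAdj, complAdj])) gemList
    (typesOf (killTree (codeTable [pathAdj, gemAdj, complAdj])) cycRows) gemCycleHints [] =
      true := by
  decide +kernel

-- No hint names a listed graph: every branch ends in a contradiction, so `K₅` is the only critical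
-- graph of this class without induced `C₅`.
set_option maxRecDepth 100000 in
theorem check_gemHints :
    (check (killTree (codeTable [pathAdj, gemAdj, complAdj, cycAdj])) gemList 30 [0]
    (typesOf (killTree (codeTable [pathAdj, gemAdj, complAdj, cycAdj])) [0]) gemHints).isSome =
      true := by
  decide +kernel

theorem all_isGood_gemList : gemList.all (isGood gemAdj) = true := by
  decide +kernel

theorem pairwise_gemList :
    gemList.Pairwise fun L M => IsEmpty (adjListGraph L ≃g adjListGraph M) :=
  pairwise_isEmpty_iso all_isGood_gemList (by decide) (by decide +kernel)

theorem critical_gem_iff {V : Type*} (G : SimpleGraph V) :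
    (IsVertexCritical 5 G ∧ IsPairFree (SimpleGraph.pathGraph 5) gem G) ↔
      ∃ L ∈ gemList, Nonempty (G ≃g adjListGraph L) :=
  critical_iff_of_certificates isSimple_gemAdj (by simp [gemList, completeList])
    all_isGood_gemList stages_gemCycleHints check_gemHints gem_isIndContained_iff
    gem_isIndContained_iff

/-! ### The case of the complement of `P₃ + P₂` -/

/-- Certificates for the types on an induced `5`-cycle; the excluded graph is the
complement of `P₃ + P₂`. -/
def coP3P2CycleHints : List (ℕ × List ℕ) := [
  (11,
    [5194, 5258, 7242, 8596261054, 5258, 6282, 3227551934, 24, 31499839868939]),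
  (5,
    [5166]),
  (15,
    [5258, 32, 7374, 48, 1126320973574835, 36168079520047, 423321523720887, 36155194618555,
     35885013935035, 282588049327031, 734637525860415, 1007728319692863, 7370, 299226513540023,
     735599598506047, 986270940271263, 735599191801915, 16, 1012272671494479, 304320458264643,
     23116063707151, 304453602250819, 23120358675275, 24, 1148878531596355, 1148878531596359,
     585929115045943, 1148878531596319, 571772903232439, 1134722319782815, 486433,
     154756942021687, 567791187534903, 31478637798455, 449297485141047, 1007994875806775,
     23116063707151, 486433, 31508702568631, 427195307548719, 704684294410571, 1012246901691423,
     35739107483667, 1104641544199, 16, 1148465808044083, 30932774716095, 1148732364161979,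
     7242, 31894847361727, 22978624753679, 32, 512545, 8430, 586065497170095, 862738952618187,
     35897886380051, 422522659803831, 590060198167499, 708665720701983, 866999550898607,
     735302977586207, 35889560842259, 1121938837511, 512545, 449318574362671, 735333042356383,
     1157399746711587, 985472076354207, 1148878263419043, 486433, 8430, 717740592472267,
     35897886380051, 449323254944055, 445062228091851, 849265895810079, 875902762624031,
     36022562353427, 1125847928839, 486433, 875932827394207, 1157532760412451, 1012272671494431,
     7210, 304307459195835, 31499839868947, 32, 7374, 48, 1139098635498163, 14298903225015,
     458363498922683, 458084594226107, 734774952100287, 1007728449323455, 7370, 999460382188191,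
     735599585796543, 735599321432507, 0, 1012272269238479, 163582957330883, 23116050997647,
     163716101317059, 0, 875932827394243, 875932827394247, 585929102336439, 1148878518886815, 8,
     1148465937674675, 1148731957457851, 453277981115071, 7210, 454102614811327, 22978612044175,
     32, 512545, 8430, 862738805829963, 36030497824915, 13366895321783, 590059791463371,
     713063360377887, 735307125765151, 35755762544659, 1121938837511, 512545, 735332895568159,
     1157399734002083, 998528374284959, 7242, 163569568330683, 31632451313811]),
  (7,
    [8, 6318, 6314, 32, 1153271750598835, 1012671965561015, 1153271750598831, 1153005864882487,
     24, 1153005995167795, 1153005995167799, 1153005995167791, 512545, 735333042356427,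
     731072425902511, 1008012055675467, 1125831151623, 512545, 735332777992395,
     1008012181512651, 1125831151623, 5342354, 56, 1157532622520475, 867411867746727,
     1003467851169999, 31907593584791, 1003600995156175, 56, 1157532358156443, 999069540425935,
     31907329220759, 999202684412111, 24, 866844663907251, 31890413716111, 594565489754819, 24,
     31890149352079, 453827737166531, 24, 876332523716811, 730505222063027, 24, 876332259352779,
     0, 56, 1157532358156455, 875933359935531, 1008278067228971, 1020625980646067, 24,
     1157532358156459, 24, 1020493238915903, 879747290911679, 32, 1156965422490303, 16, 56,
     1157399746711591, 1008278075490347, 1020351367111347, 24, 1156690808955583, 24, 6378,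
     731072425902515, 6382, 31632715677847, 31632451313815, 31615535809167, 31615271445135]),
  (31,
    [0, 846658277383])]

/-- Certificate for graphs without induced `5`-cycles; the excluded graph is the
complement of `P₃ + P₂`. -/
def coP3P2Hints : List ℕ :=
  [0, 0, 1098, 106, 2090, 8, 6314, 5322, 1258, 48, 10506, 8526, 60, 52, 48, 9704772894, 8366, 40,
   8426, 7438, 7438, 8430, 56, 8633096446, 8430, 8430, 44, 24, 36, 7306, 4334, 7310, 6314, 60, 44,
   8, 7370, 6382, 6382, 7374, 12, 12, 12, 12, 12, 12, 8, 32, 512165, 12, 12, 12, 8, 28, 12, 12,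
   24, 5436965022, 28, 16, 4202, 3114, 3210, 170, 32, 9450, 7470, 60, 9454, 9454, 3210, 2218, 32,
   8394, 6414, 44, 36, 32, 7588678878, 6254, 24, 6314, 5326, 5326, 5326, 6318, 40, 6517002430,
   6318, 6318, 28, 24, 40, 24, 484517, 6254, 4300276862, 28, 4202, 40, 28, 6254, 24, 6510710974,
   16, 5258, 4270, 4270, 4270, 4270, 5262, 20, 0, 3146, 2154, 1162, 24, 7338, 5358, 44, 7342,
   2154, 24, 6314, 5326, 36, 142, 24, 6446745790, 16, 5258, 4270, 4270, 4270, 32, 5375069342,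
   5262, 0, 4202, 3214, 3214, 3214, 3214]

-- Now `15` and `31`, with four and five neighbours on the cycle, have to be treated too. At type
-- `31`, treated last, a vertex of the cycle needs a fourth neighbour, which must again be joined to
-- the whole cycle. If the two centres are not adjacent, they form the forbidden graph with an edge
-- and a vertex of the cycle; if they are, the second graph of the list appears.
set_option maxRecDepth 100000 in
theorem stages_coP3P2CycleHints :
    stages (killTree (codeTable [pathAdj, coAdj, complAdj])) coP3P2List
    (typesOf (killTree (codeTable [pathAdj, coAdj, complAdj])) cycRows) coP3P2CycleHints [] =
      true := by
  decide +kernel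

-- As for the gem, no listed graph is named by a hint.
set_option maxRecDepth 100000 in
theorem check_coP3P2Hints :
    (check (killTree (codeTable [pathAdj, coAdj, complAdj, cycAdj])) coP3P2List 30 [0]
    (typesOf (killTree (codeTable [pathAdj, coAdj, complAdj, cycAdj])) [0]) coP3P2Hints).isSome =
      true := by
  decide +kernel

theorem all_isGood_coP3P2List : coP3P2List.all (isGood coAdj) = true := by
  decide +kernel

theorem pairwise_coP3P2List :
    coP3P2List.Pairwise fun L M => IsEmpty (adjListGraph L ≃g adjListGraph M) :=
  pairwise_isEmpty_iso all_isGood_coP3P2List (by decide) (by decide +kernel)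

theorem critical_coP3P2_iff {V : Type*} (G : SimpleGraph V) :
    (IsVertexCritical 5 G ∧ IsPairFree (SimpleGraph.pathGraph 5) coP3P2 G) ↔
      ∃ L ∈ coP3P2List, Nonempty (G ≃g adjListGraph L) :=
  critical_iff_of_certificates isSimple_coAdj (by simp [coP3P2List, completeList])
    all_isGood_coP3P2List stages_coP3P2CycleHints check_coP3P2Hints coP3P2_isIndContained_iff
    coP3P2_isIndContained_iff

theorem theorem3p4 :
    ((criticalClasses 5 (SimpleGraph.pathGraph 5) gem).encard = 7 ∧
      (∀ (V : Type*) [Finite V] (G : SimpleGraph V),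
        (IsVertexCritical 5 G ∧ IsPairFree (SimpleGraph.pathGraph 5) gem G) ↔
          ∃ L ∈ gemList, Nonempty (G ≃g adjListGraph L)) ∧
      gemList.Pairwise fun L M => IsEmpty (adjListGraph L ≃g adjListGraph M)) ∧
    ((criticalClasses 5 (SimpleGraph.pathGraph 5) coP3P2).encard = 20 ∧
      (∀ (V : Type*) [Finite V] (G : SimpleGraph V),
        (IsVertexCritical 5 G ∧ IsPairFree (SimpleGraph.pathGraph 5) coP3P2 G) ↔
          ∃ L ∈ coP3P2List, Nonempty (G ≃g adjListGraph L)) ∧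
      coP3P2List.Pairwise fun L M => IsEmpty (adjListGraph L ≃g adjListGraph M)) := by
  exact ⟨⟨encard_criticalClasses (fun _ _ G => critical_gem_iff G) pairwise_gemList,
    fun _ _ G => critical_gem_iff G, pairwise_gemList⟩,
    encard_criticalClasses (fun _ _ G => critical_coP3P2_iff G) pairwise_coP3P2List,
    fun _ _ G => critical_coP3P2_iff G, pairwise_coP3P2List⟩
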